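/- Let $n\ge 2$ be an integer and let $0<s<t<1$. Let $B\subset\mathbb{R}^n$ be the closed unit ball, $\partial B$ the unit sphere with surface measure $\sigma$, and for $u\colon\partial B\to\mathbb{R}$ put $E_u=\{r(1+u(x))x : r\in[0,1],\ x\in\partial B\}$. For $\alpha\in(0,1)$ and Borel $E\subset\mathbb{R}^n$ let $$P_\alpha(E)=\int_E\int_{E^c}\frac{dx\,dy}{|x-y|^{n+\alpha}},\qquad \mathcal F(E)=\frac{P_t(E)^{1/(n-t)}}{P_s(E)^{1/(n-s)}},$$ write $\mathcal F(u)=\mathcal F(E_u)$, and let $\delta\mathcal F(u)[\varphi]=\frac{d}{d\lambda}\big|_{\lambda=0}\mathcal F(u+\lambda\varphi)$ and $\delta^2\mathcal F(u)[\varphi,\psi]=\frac{d}{d\lambda}\big|_{\lambda=0}\delta\mathcal F(u+\lambda\psi)[\varphi]$. For $u\in C^1(\partial B)$ let $\|u\|_{C^1}=\max\{\sup_{\partial B}|u|,\ \sup_{\partial B}|\nabla_\tau u|\}$, where $\nabla_\tau$ is the tangential gradient, and for $\beta\in(0,1)$ let $$\|u\|_{H^{\beta}}^2=\int_{\partial B}u^2\,d\sigma+\int_{\partial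 B}\int_{\partial B}\frac{(u(x)-u(y))^2}{|x-y|^{n-1+2\beta}}\,d\sigma_x\,d\sigma_y .$$ Then there is a constant $C=C(n,s,t)>0$ such that for every $u\in C^1(\partial B)$ with $\|u\|_{C^1}\le\frac12$ and $|E_u|=|B|$, the perimeters $P_s(E_{\lambda u})$ and $P_t(E_{\lambda u})$ are positive and finite for all $\lambda\in[0,1]$, the second variations $\delta^2\mathcal F(u)[u,u]$ and $\delta^2\mathcal F(0)[u,u]$ exist, and $$\bigl|\delta^2\mathcal F(u)[u,u]-\delta^2\mathcal F(0)[u,u]\bigr|\le C\,\|u\|_{C^1}\,\|u\|_{H^{\frac{1+t}{2}}}^2 .$$ -/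

import Mathlib

open MeasureTheory Set Filter Topology
open scoped ENNReal

noncomputable section

namespace FracIso

/-- Euclidean space `ℝⁿ`. -/
abbrev Eucl (n : ℕ) : Type := EuclideanSpace ℝ (Fin n)

/-- The unit sphere `∂B` of `ℝⁿ`. -/
abbrev USphere (n : ℕ) : Type := Metric.sphere (0 : Eucl n) 1

/-- The surface measure `dσ` on the unit sphere (the measure occurring in polar coordinates). -/
def surf (n : ℕ) : Measure (USphere n) := (volume : Measure (Eucl n)).toSphere

/-- The radial projection `x ↦ x / |x|` of a nonzero vector to the unit sphere. -/
def radialProj {n : ℕ} (x : Eucl n) (hx : x ≠ 0) : USphere n :=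
  ⟨‖x‖⁻¹ • x, by
    rw [mem_sphere_zero_iff_norm, norm_smul, norm_inv, norm_norm,
      inv_mul_cancel₀ (norm_ne_zero_iff.mpr hx)]⟩

open Classical in
/-- The extension of `u : ∂B → ℝ` to `ℝⁿ ∖ {0}` that is constant along rays,
`x ↦ u (x / |x|)` (with the irrelevant value `0` at the origin). -/
def homExt {n : ℕ} (u : USphere n → ℝ) (x : Eucl n) : ℝ :=
  if hx : x ≠ 0 then u (radialProj x hx) else 0

/-- `u ∈ C¹(∂B)`: the extension of `u` that is constant along rays is `C¹` on `ℝⁿ ∖ {0}`. -/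
def IsC1 {n : ℕ} (u : USphere n → ℝ) : Prop :=
  ContDiffOn ℝ 1 (homExt u) {0}ᶜ

/-- The length `|∇_τ u (x)|` of the tangential gradient of `u` at `x ∈ ∂B`. The extension of `u` is
constant in the radial direction, so its differential at `x` is that of `u` on the tangent space
`x^⊥` and vanishes on the normal line. -/
def tangGradNorm {n : ℕ} (u : USphere n → ℝ) (x : USphere n) : ℝ :=
  ‖fderiv ℝ (homExt u) (x : Eucl n)‖

/-- The `C¹` norm `max (sup |u|, sup |∇_τ u|)`. -/
def c1Norm {n : ℕ} (u : USphere n → ℝ) : ℝ :=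
  max (⨆ x : USphere n, |u x|) (⨆ x : USphere n, tangGradNorm u x)

/-- The squared Gagliardo seminorm `[u]²_{H^β(∂B)}`. -/
def gagliardoSq {n : ℕ} (β : ℝ) (u : USphere n → ℝ) : ℝ :=
  ∫ p : USphere n × USphere n,
    (u p.1 - u p.2) ^ 2 / ‖(p.1 : Eucl n) - (p.2 : Eucl n)‖ ^ ((n : ℝ) - 1 + 2 * β)
    ∂((surf n).prod (surf n))

/-- The norm of `H^β(∂B)`. -/
def sobolevNorm {n : ℕ} (β : ℝ) (u : USphere n → ℝ) : ℝ :=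
  Real.sqrt ((∫ x, u x ^ 2 ∂(surf n)) + gagliardoSq β u)

/-- The graph perturbation `E_u = {r (1 + u x) x : r ∈ [0,1], x ∈ ∂B}` of the unit ball. -/
def graphSet {n : ℕ} (u : USphere n → ℝ) : Set (Eucl n) :=
  {z | ∃ r ∈ Icc (0 : ℝ) 1, ∃ x : USphere n, z = (r * (1 + u x)) • (x : Eucl n)}

/-- The fractional perimeter `P_α(E) = ∫_E ∫_{Eᶜ} |x - y|^{-(n+α)} dy dx ∈ [0, ∞]`. -/
def fracPerimeter {n : ℕ} (α : ℝ) (E : Set (Eucl n)) : ℝ≥0∞ :=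
  ∫⁻ x in E, ∫⁻ y in Eᶜ, ENNReal.ofReal (1 / ‖x - y‖ ^ ((n : ℝ) + α))

/-- The isoperimetric ratio `P_t(E)^{1/(n-t)} / P_s(E)^{1/(n-s)}`. -/
def isoRatio {n : ℕ} (s t : ℝ) (E : Set (Eucl n)) : ℝ :=
  (fracPerimeter t E).toReal ^ (1 / ((n : ℝ) - t)) /
    (fracPerimeter s E).toReal ^ (1 / ((n : ℝ) - s))

/-- The isoperimetric ratio as a functional of `u`: `ℱ(u) = ℱ(E_u)`. -/
def ratioFun {n : ℕ} (s t : ℝ) (u : USphere n → ℝ) : ℝ := isoRatio s t (graphSet u)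

/-- The first variation `δJ(u)[φ] = d/dr J(u + r φ)` at `r = 0`. -/
def firstVariation {n : ℕ} (J : (USphere n → ℝ) → ℝ) (u φ : USphere n → ℝ) : ℝ :=
  deriv (fun r : ℝ => J (u + r • φ)) 0

/-- The second variation `δ²J(u)[φ, ψ] = d/dr δJ(u + r ψ)[φ]` at `r = 0`. -/
def secondVariation {n : ℕ} (J : (USphere n → ℝ) → ℝ) (u φ ψ : USphere n → ℝ) : ℝ :=
  deriv (fun r : ℝ => firstVariation J (u + r • ψ) φ) 0

/-- Both derivatives in the definition of `δ²J(u)[φ, ψ]` exist. -/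
def HasSecondVariation {n : ℕ} (J : (USphere n → ℝ) → ℝ) (u φ ψ : USphere n → ℝ) : Prop :=
  (∀ᶠ q : ℝ in 𝓝 0, DifferentiableAt ℝ (fun r : ℝ => J (u + q • ψ + r • φ)) 0) ∧
    DifferentiableAt ℝ (fun r : ℝ => firstVariation J (u + r • ψ) φ) 0

end FracIso

end

/-! Along the ray `l ↦ l • u` everything reduces to one real variable: with `g l = ℱ(l u)`, the two
second variations are `g'' 1` and `g'' 0`. So `g` must be twice differentiable on an open interval
around `[0, 1]`, with `|g'' 1 - g'' 0| ≤ C ε h²`, where `ε` is the C¹ norm of `u` and `h` its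
`H^{(1+t)/2}` norm.

The main tool is an exact formula for the perimeter. In polar coordinates `P_α(E_u)` is a double
integral over the sphere of the radial kernel on `(0, 1 + u ξ] × (1 + u η, ∞)`. Adding the term with
`ξ` and `η` exchanged and rearranging rectangles (`quadInt_add_quadInt_swap`) leaves two diagonal
terms, which scale as `(1 + u)^(n - α)` times the density of the ball, and the integral of the
kernel over the square between the two radii (`two_mul_fracPerimeter_graphSet`). When this square is
parametrized by `[0, 1]²`, the singularity factors out exactly as the Gagliardo density `(u ξ - u
η)² / |ξ - η|^(n + α)`; what remains, `smoothKer`, is smooth in `l` and in parameters `z` of size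
`O(ε)` (`sq_mul_radKer_eq`).

Differentiation under the integral is then harmless. The gain of `ε` comes from `smoothKer (l, 0) =
l²`: its second derivative in `l` is constant at `z = 0`, so its values at `l = 1` and `l = 0`
differ by `O(‖z‖)` (`exists_bound_pderiv`). In the diagonal term, `|(1 + u)^k - 1| = O(ε)` plays the
same role.

Finally `ℱ` is the exponential of a linear combination of logarithms of perimeters that are
uniformly bounded below, and estimates of this type are preserved by smooth functions (`Ctrl.comp`).
-/

noncomputable section

namespace FracIso

/-! ### Polar coordinates: the perimeter as a double integral over the sphere. -/

/-- Integration in polar coordinates. -/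
lemma lintegral_polar {n : ℕ} (hn : 1 ≤ n) {f : Eucl n → ℝ≥0∞} (hf : Measurable f) :
    ∫⁻ x, f x = ∫⁻ ξ, (∫⁻ r in Ioi (0 : ℝ),
      ENNReal.ofReal (r ^ (n - 1)) * f (r • (ξ : Eucl n))) ∂(surf n) := by
  have : Nonempty (Fin n) := ⟨⟨0, hn⟩⟩
  have hms : MeasurableSet ({(0 : Eucl n)}ᶜ) := (measurableSet_singleton _).compl
  have hmeas : Measurable fun p : USphere n × Ioi (0 : ℝ) => f (p.2.1 • (p.1 : Eucl n)) :=
    hf.comp (by fun_prop)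
  have h1 : ∫⁻ x, f x = ∫⁻ x : ({(0 : Eucl n)}ᶜ : Set (Eucl n)), f x
      ∂((volume : Measure (Eucl n)).comap (↑)) := by
    rw [lintegral_subtype_comap hms, restrict_compl_singleton]
  have h2 := (volume : Measure (Eucl n)).measurePreserving_homeomorphUnitSphereProd.lintegral_comp
    hmeas
  rw [h1, surf]
  have h3 : ∀ x : ({(0 : Eucl n)}ᶜ : Set (Eucl n)),
      f ((homeomorphUnitSphereProd (Eucl n) x).2.1 •
        ((homeomorphUnitSphereProd (Eucl n) x).1 : Eucl n)) = f x := by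
    intro x
    congr 1
    have hx : ‖(x : Eucl n)‖ ≠ 0 := norm_ne_zero_iff.2 x.2
    simp [smul_smul, hx]
  simp only [h3] at h2
  rw [h2, lintegral_prod _ hmeas.aemeasurable]
  refine lintegral_congr fun ξ => ?_
  have hm : Measurable fun r : Ioi (0 : ℝ) => f (r.1 • (ξ : Eucl n)) := hf.comp (by fun_prop)
  simp only [Measure.volumeIoiPow]
  rw [lintegral_withDensity_eq_lintegral_mul _ (by fun_prop) hm]
  simp only [Pi.mul_apply, finrank_euclideanSpace_fin]
  exact lintegral_subtype_comap measurableSet_Ioi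
    fun r : ℝ => ENNReal.ofReal (r ^ (n - 1)) * f (r • (ξ : Eucl n))

lemma norm_sphere {n : ℕ} (ξ : USphere n) : ‖(ξ : Eucl n)‖ = 1 := by
  simp

/-- Both sides expand through the inner product of `ξ` and `η`. The kernel therefore sees the two
directions only through the chordal distance, the parameter `θ` of `radKer`. -/
lemma norm_sub_smul_sphere_sq {n : ℕ} (ξ η : USphere n) (r ρ : ℝ) :
    ‖r • (ξ : Eucl n) - ρ • (η : Eucl n)‖ ^ 2 =
      (r - ρ) ^ 2 + r * ρ * ‖(ξ : Eucl n) - (η : Eucl n)‖ ^ 2 := by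
  rw [norm_sub_sq_real, norm_sub_sq_real, norm_smul, norm_smul, norm_sphere, norm_sphere,
    inner_smul_left, inner_smul_right]
  simp only [Real.norm_eq_abs, mul_one, sq_abs, one_pow, conj_trivial]
  ring

/-- The radial kernel `r^{n-1} ρ^{n-1} / ((r-ρ)² + r ρ θ²)^{γ/2}`. -/
def radKer (n : ℕ) (γ θ r ρ : ℝ) : ℝ :=
  r ^ (n - 1) * ρ ^ (n - 1) / ((r - ρ) ^ 2 + r * ρ * θ ^ 2) ^ (γ / 2)

lemma measurable_radKer (n : ℕ) (γ : ℝ) :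
    Measurable fun p : ℝ × ℝ × ℝ => radKer n γ p.1 p.2.1 p.2.2 := by
  unfold radKer; fun_prop

lemma Measurable.radKer {X : Type*} [MeasurableSpace X] (n : ℕ) (γ : ℝ) {f g h : X → ℝ}
    (hf : Measurable f) (hg : Measurable g) (hh : Measurable h) :
    Measurable fun x => radKer n γ (f x) (g x) (h x) :=
  (measurable_radKer n γ).comp (hf.prodMk (hg.prodMk hh))

lemma norm_rpow_eq_radial {n : ℕ} (γ : ℝ) (ξ η : USphere n) (r ρ : ℝ) :
    ‖r • (ξ : Eucl n) - ρ • (η : Eucl n)‖ ^ γ =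
      ((r - ρ) ^ 2 + r * ρ * ‖(ξ : Eucl n) - (η : Eucl n)‖ ^ 2) ^ (γ / 2) := by
  rw [← norm_sub_smul_sphere_sq, ← Real.rpow_natCast, ← Real.rpow_mul (norm_nonneg _)]
  congr 1
  push_cast; ring

/-- Taking norms in `r ξ = q (1 + u x) x` recovers first the radius and then the direction;
positivity of `1 + u` makes this representation unique. -/
lemma mem_graphSet_smul {n : ℕ} {u : USphere n → ℝ} {ξ : USphere n} (hu : ∀ x, 0 < 1 + u x)
    {r : ℝ} (hr : 0 < r) : r • (ξ : Eucl n) ∈ graphSet u ↔ r ≤ 1 + u ξ := by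
  constructor
  · rintro ⟨q, hq, x, hx⟩
    have h1 : r = q * (1 + u x) := by
      have := congrArg norm hx
      rw [norm_smul, norm_smul, norm_sphere, norm_sphere, Real.norm_of_nonneg hr.le,
        Real.norm_of_nonneg (mul_nonneg hq.1 (hu x).le)] at this
      simpa using this
    rw [← h1] at hx
    have h2 : ξ = x := Subtype.ext (smul_right_injective _ hr.ne' hx)
    subst h2
    rw [h1]
    nlinarith [hq.2, hu ξ]
  · intro h
    refine ⟨r / (1 + u ξ), ⟨by have := hu ξ; positivity, (div_le_one (hu ξ)).2 h⟩, ξ, ?_⟩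
    rw [div_mul_cancel₀ _ (hu ξ).ne']

lemma isCompact_graphSet {n : ℕ} {u : USphere n → ℝ} (hu : Continuous u) :
    IsCompact (graphSet u) := by
  have : graphSet u = (fun p : ℝ × USphere n => (p.1 * (1 + u p.2)) • (p.2 : Eucl n)) ''
      (Icc (0 : ℝ) 1 ×ˢ univ) := by
    ext z
    simp only [graphSet, mem_ofPred_eq, mem_image, mem_prod, mem_univ, and_true, Prod.exists]
    constructor
    · rintro ⟨r, hr, x, hx⟩; exact ⟨r, x, hr, hx.symm⟩
    · rintro ⟨r, x, hr, hx⟩; exact ⟨r, hr, x, hx.symm⟩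
  rw [this]
  exact (isCompact_Icc.prod isCompact_univ).image (by fun_prop)

lemma measurableSet_graphSet {n : ℕ} {u : USphere n → ℝ} (hu : Continuous u) :
    MeasurableSet (graphSet u) := (isCompact_graphSet hu).measurableSet

instance (n : ℕ) : IsFiniteMeasure (surf n) := by unfold surf; infer_instance

/-- The integral of the radial kernel over `(0, a] × (b, ∞)`. -/
def quadInt (n : ℕ) (γ θ a b : ℝ) : ℝ≥0∞ :=
  ∫⁻ r in Ioc 0 a, ∫⁻ ρ in Ioi b, ENNReal.ofReal (radKer n γ θ r ρ)

lemma setLIntegral_polar {n : ℕ} (hn : 1 ≤ n) {f : Eucl n → ℝ≥0∞} (hf : Measurable f)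
    {E : Set (Eucl n)} (hE : MeasurableSet E) {A : USphere n → Set ℝ}
    (hA : ∀ ξ, A ξ ⊆ Ioi 0) (hAm : ∀ ξ, MeasurableSet (A ξ))
    (h : ∀ (ξ : USphere n) (r : ℝ), 0 < r → (r • (ξ : Eucl n) ∈ E ↔ r ∈ A ξ)) :
    ∫⁻ x in E, f x = ∫⁻ ξ, (∫⁻ r in A ξ,
      ENNReal.ofReal (r ^ (n - 1)) * f (r • (ξ : Eucl n))) ∂(surf n) := by
  rw [← lintegral_indicator hE, lintegral_polar hn (hf.indicator hE)]
  refine lintegral_congr fun ξ => ?_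
  rw [← lintegral_indicator measurableSet_Ioi, ← lintegral_indicator (hAm ξ)]
  refine lintegral_congr fun r => ?_
  by_cases hr : 0 < r
  · rw [indicator_of_mem (show r ∈ Ioi (0 : ℝ) from hr)]
    by_cases hr2 : r ∈ A ξ
    · rw [indicator_of_mem hr2, indicator_of_mem ((h ξ r hr).2 hr2)]
    · rw [indicator_of_notMem hr2, indicator_of_notMem (fun h' => hr2 ((h ξ r hr).1 h')), mul_zero]
  · rw [indicator_of_notMem (show r ∉ Ioi (0 : ℝ) from hr), indicator_of_notMem]
    exact fun h' => hr (hA ξ h')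

/-- The Jacobian `r^(n-1)` of the outer integration is carried along so that, together with the
inner one, it forms the numerator of `radKer`. -/
lemma ofReal_mul_setLIntegral_compl_graphSet {n : ℕ} (hn : 1 ≤ n) (α : ℝ) {u : USphere n → ℝ}
    (huc : Continuous u) (hu : ∀ x, 0 < 1 + u x) (ξ : USphere n) {r : ℝ} (hr : 0 < r) :
    ENNReal.ofReal (r ^ (n - 1)) *
      ∫⁻ y in (graphSet u)ᶜ, ENNReal.ofReal (1 / ‖r • (ξ : Eucl n) - y‖ ^ ((n : ℝ) + α)) =
      ∫⁻ η, (∫⁻ ρ in Ioi (1 + u η), ENNReal.ofReal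
        (radKer n (n + α) ‖(ξ : Eucl n) - (η : Eucl n)‖ r ρ)) ∂(surf n) := by
  rw [setLIntegral_polar hn (A := fun η => Ioi (1 + u η))
    (f := fun y => ENNReal.ofReal (1 / ‖r • (ξ : Eucl n) - y‖ ^ ((n : ℝ) + α)))
    (by fun_prop) (measurableSet_graphSet huc).compl
    (fun η => Ioi_subset_Ioi (hu η).le) (fun η => measurableSet_Ioi) (fun η ρ hρ => by
    rw [mem_compl_iff, mem_graphSet_smul hu hρ]; simp),
    ← lintegral_const_mul' _ _ ENNReal.ofReal_ne_top]
  refine lintegral_congr fun η => ?_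
  rw [← lintegral_const_mul' _ _ ENNReal.ofReal_ne_top]
  refine setLIntegral_congr_fun measurableSet_Ioi fun ρ hρ => ?_
  have hρ0 : 0 < ρ := (hu η).trans hρ
  rw [norm_rpow_eq_radial, radKer, ← ENNReal.ofReal_mul (by positivity),
    ← ENNReal.ofReal_mul (by positivity)]
  congr 1
  ring

lemma lintegral_quadInt {n : ℕ} (γ : ℝ) {b : USphere n → ℝ} (hb : Measurable b) (ξ : USphere n)
    (a : ℝ) :
    ∫⁻ η, quadInt n γ ‖(ξ : Eucl n) - (η : Eucl n)‖ a (b η) ∂(surf n) =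
      ∫⁻ r in Ioc 0 a, ∫⁻ η, (∫⁻ ρ in Ioi (b η), ENNReal.ofReal
        (radKer n γ ‖(ξ : Eucl n) - (η : Eucl n)‖ r ρ)) ∂(surf n) := by
  unfold quadInt
  rw [lintegral_lintegral_swap]
  have : (fun p : USphere n × ℝ => ∫⁻ ρ in Ioi (b p.1), ENNReal.ofReal
        (radKer n γ ‖(ξ : Eucl n) - (p.1 : Eucl n)‖ p.2 ρ)) =
      fun p => ∫⁻ ρ, {q : (USphere n × ℝ) × ℝ | b q.1.1 < q.2}.indicator (fun q =>
        ENNReal.ofReal (radKer n γ ‖(ξ : Eucl n) - (q.1.1 : Eucl n)‖ q.1.2 q.2)) (p, ρ) := by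
    ext p
    rw [← lintegral_indicator measurableSet_Ioi]
    rfl
  apply Measurable.aemeasurable
  simp only [Function.uncurry_def]
  rw [this]
  refine Measurable.lintegral_prod_right' (Measurable.indicator ?_ ?_)
  · exact ENNReal.measurable_ofReal.comp (Measurable.radKer _ _ (by fun_prop) (by fun_prop)
      (by fun_prop))
  · exact measurableSet_lt (by fun_prop) (by fun_prop)

lemma fracPerimeter_graphSet_eq {n : ℕ} (hn : 1 ≤ n) (α : ℝ) {u : USphere n → ℝ}
    (huc : Continuous u) (hu : ∀ x, 0 < 1 + u x) :
    fracPerimeter α (graphSet u) = ∫⁻ ξ, ∫⁻ η, quadInt n (n + α) ‖(ξ : Eucl n) - (η : Eucl n)‖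
      (1 + u ξ) (1 + u η) ∂(surf n) ∂(surf n) := by
  have hE := measurableSet_graphSet huc
  unfold fracPerimeter
  have hk : Measurable fun p : Eucl n × Eucl n =>
      ENNReal.ofReal (1 / ‖p.1 - p.2‖ ^ ((n : ℝ) + α)) := by fun_prop
  rw [setLIntegral_polar hn (A := fun ξ => Ioc 0 (1 + u ξ)) hk.lintegral_prod_right' hE
    (fun ξ => Ioc_subset_Ioi_self) (fun ξ => measurableSet_Ioc) (fun ξ r hr => by
      rw [mem_graphSet_smul hu hr]; simp [hr])]
  refine lintegral_congr fun ξ => ?_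
  rw [lintegral_quadInt _ (b := fun η => 1 + u η) (huc.measurable.const_add 1)]
  exact setLIntegral_congr_fun measurableSet_Ioc fun r hr =>
    ofReal_mul_setLIntegral_compl_graphSet hn α huc hu ξ hr.1

/-! ### Symmetrization: diagonal terms and the square between two radii. -/

lemma setLIntegral_image_affine (b : ℝ) {c : ℝ} (hc : c ≠ 0) {S : Set ℝ} (hS : MeasurableSet S)
    (f : ℝ → ℝ≥0∞) :
    ∫⁻ r in (fun p => b + c * p) '' S, f r = ENNReal.ofReal |c| * ∫⁻ p in S, f (b + c * p) := by
  rw [lintegral_image_eq_lintegral_abs_deriv_mul hS (f' := fun _ => c)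
    (fun x _ => by simpa using (((hasDerivAt_id x).const_mul c).const_add b).hasDerivWithinAt)
    (fun x _ y _ h => by simpa [hc] using h),
    lintegral_const_mul' _ _ ENNReal.ofReal_ne_top]

lemma setLIntegral_uIoc_eq (a b : ℝ) (f : ℝ → ℝ≥0∞) :
    ∫⁻ r in uIoc b a, f r =
      ENNReal.ofReal |a - b| * ∫⁻ p in Icc (0 : ℝ) 1, f (b + (a - b) * p) := by
  rcases eq_or_ne a b with rfl | hab
  · simp
  have hc : a - b ≠ 0 := sub_ne_zero.2 hab
  rw [← setLIntegral_image_affine b hc measurableSet_Icc]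
  have h1 : (fun p => b + (a - b) * p) '' Icc (0 : ℝ) 1 = uIcc b a := by
    have : (fun p : ℝ => b + (a - b) * p) = (fun x => b + x) ∘ (fun p => (a - b) * p) := rfl
    rw [this, image_comp, ← uIcc_of_le (zero_le_one' ℝ), image_const_mul_uIcc,
      image_const_add_uIcc]
    simp
  rw [h1, uIcc, uIoc, Measure.restrict_congr_set Ioc_ae_eq_Icc]

lemma setLIntegral_Ioc_scale {a : ℝ} (ha : 0 < a) (f : ℝ → ℝ≥0∞) :
    ∫⁻ r in Ioc 0 a, f r = ENNReal.ofReal a * ∫⁻ p in Ioc (0 : ℝ) 1, f (a * p) := by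
  have h := setLIntegral_image_affine 0 ha.ne' (S := Ioc 0 1) measurableSet_Ioc f
  simp only [zero_add, abs_of_pos ha] at h
  rw [← h]
  congr 2
  ext x
  simp only [mem_Ioc, mem_image]
  exact ⟨fun h => ⟨x / a, ⟨div_pos h.1 ha, (div_le_one ha).2 h.2⟩, by field_simp⟩,
    fun ⟨p, hp, hpx⟩ => by rw [← hpx]; exact ⟨mul_pos ha hp.1, by nlinarith [hp.2]⟩⟩

lemma setLIntegral_Ioi_scale {a : ℝ} (ha : 0 < a) (f : ℝ → ℝ≥0∞) :
    ∫⁻ r in Ioi a, f r = ENNReal.ofReal a * ∫⁻ p in Ioi (1 : ℝ), f (a * p) := by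
  have h := setLIntegral_image_affine 0 ha.ne' (S := Ioi 1) measurableSet_Ioi f
  simp only [zero_add, abs_of_pos ha] at h
  rw [← h]
  congr 2
  ext x
  simp only [mem_Ioi, mem_image]
  exact ⟨fun h => ⟨x / a, (one_lt_div ha).2 h, by field_simp⟩,
    fun ⟨p, hp, hpx⟩ => by rw [← hpx]; nlinarith⟩

/-- The numerator is homogeneous of degree `2 (n - 1)`, the denominator of degree `γ`, and the two
extra factors `a` are the Jacobians of the two radial variables. -/
lemma radKer_scale {n : ℕ} (hn : 1 ≤ n) (γ θ : ℝ) {a r ρ : ℝ} (ha : 0 < a) (hr : 0 < r)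
    (hρ : 0 < ρ) :
    a * (a * radKer n γ θ (a * r) (a * ρ)) = a ^ (2 * n - γ) * radKer n γ θ r ρ := by
  obtain ⟨m, rfl⟩ := Nat.exists_eq_add_of_le hn
  unfold radKer
  have h1 : (a * r - a * ρ) ^ 2 + a * r * (a * ρ) * θ ^ 2 =
      a ^ 2 * ((r - ρ) ^ 2 + r * ρ * θ ^ 2) := by ring
  have h2 : (a ^ 2) ^ (γ / 2) = a ^ γ := by
    rw [← Real.rpow_natCast, ← Real.rpow_mul ha.le]; congr 1; push_cast; ring
  have h3 : a ^ ((2 : ℝ) * ((1 + m : ℕ) : ℝ) - γ) = a ^ (2 * (1 + m)) / a ^ γ := by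
    rw [Real.rpow_sub ha, ← Real.rpow_natCast]; push_cast; rfl
  rw [h1, Real.mul_rpow (by positivity) (by positivity), h2, h3]
  simp only [Nat.add_sub_cancel_left, mul_pow]
  rw [show 2 * (1 + m) = m + m + 2 by ring, pow_add, pow_add]
  have : a ^ γ ≠ 0 := (Real.rpow_pos_of_pos ha _).ne'
  field_simp

lemma quadInt_self_eq {n : ℕ} (hn : 1 ≤ n) (γ θ : ℝ) {a : ℝ} (ha : 0 < a) :
    quadInt n γ θ a a = ENNReal.ofReal (a ^ (2 * n - γ)) * quadInt n γ θ 1 1 := by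
  unfold quadInt
  rw [setLIntegral_Ioc_scale ha, ← lintegral_const_mul' _ _ ENNReal.ofReal_ne_top,
    ← lintegral_const_mul' _ _ ENNReal.ofReal_ne_top]
  refine setLIntegral_congr_fun measurableSet_Ioc fun r hr => ?_
  rw [setLIntegral_Ioi_scale ha, ← lintegral_const_mul' _ _ ENNReal.ofReal_ne_top,
    ← lintegral_const_mul' _ _ ENNReal.ofReal_ne_top,
    ← lintegral_const_mul' _ _ ENNReal.ofReal_ne_top]
  refine setLIntegral_congr_fun measurableSet_Ioi fun ρ hρ => ?_
  have hρ' : 0 < ρ := zero_lt_one.trans hρ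
  rw [← ENNReal.ofReal_mul ha.le, ← ENNReal.ofReal_mul ha.le,
    ← ENNReal.ofReal_mul (by positivity), radKer_scale hn _ _ ha hr.1 hρ']

/-- The variable limits of integration are absorbed into the indicator of a measurable set in the
product space, so that Tonelli measurability applies. -/
lemma measurable_quadInt {X : Type*} [MeasurableSpace X] (n : ℕ) (γ : ℝ) {f g h : X → ℝ}
    (hf : Measurable f) (hg : Measurable g) (hh : Measurable h) :
    Measurable fun x => quadInt n γ (f x) (g x) (h x) := by
  have : (fun x => quadInt n γ (f x) (g x) (h x)) = fun x => ∫⁻ r, ∫⁻ ρ,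
      {q : (X × ℝ) × ℝ | (0 < q.1.2 ∧ q.1.2 ≤ g q.1.1) ∧ h q.1.1 < q.2}.indicator (fun q =>
        ENNReal.ofReal (radKer n γ (f q.1.1) q.1.2 q.2)) ((x, r), ρ) := by
    ext x
    unfold quadInt
    rw [← lintegral_indicator measurableSet_Ioc]
    refine lintegral_congr fun r => ?_
    by_cases hr : 0 < r ∧ r ≤ g x
    · rw [indicator_of_mem (show r ∈ Ioc 0 (g x) from hr), ← lintegral_indicator measurableSet_Ioi]
      refine lintegral_congr fun ρ => ?_
      by_cases hρ : h x < ρ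
      · rw [indicator_of_mem (show ρ ∈ Ioi (h x) from hρ), indicator_of_mem (by exact ⟨hr, hρ⟩)]
      · rw [indicator_of_notMem (show ρ ∉ Ioi (h x) from hρ),
          indicator_of_notMem (fun h' => hρ h'.2)]
    · rw [indicator_of_notMem (show r ∉ Ioc 0 (g x) from hr)]
      refine Eq.symm ((lintegral_congr fun ρ => ?_).trans lintegral_zero)
      exact indicator_of_notMem (fun h' => hr h'.1) _
  rw [this]
  have hm : Measurable ({q : (X × ℝ) × ℝ | (0 < q.1.2 ∧ q.1.2 ≤ g q.1.1) ∧
      h q.1.1 < q.2}.indicator (fun q => ENNReal.ofReal (radKer n γ (f q.1.1) q.1.2 q.2))) := by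
    refine Measurable.indicator ?_ ?_
    · exact ENNReal.measurable_ofReal.comp (Measurable.radKer _ _ (by fun_prop) (by fun_prop)
        (by fun_prop))
    · have h1 : MeasurableSet {q : (X × ℝ) × ℝ | 0 < q.1.2} :=
        measurableSet_lt (by fun_prop) (by fun_prop)
      have h2 : MeasurableSet {q : (X × ℝ) × ℝ | q.1.2 ≤ g q.1.1} :=
        measurableSet_le (by fun_prop) (by fun_prop)
      have h3 : MeasurableSet {q : (X × ℝ) × ℝ | h q.1.1 < q.2} :=
        measurableSet_lt (by fun_prop) (by fun_prop)
      exact (h1.inter h2).inter h3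
  exact hm.lintegral_prod_right'.lintegral_prod_right'

/-- Cut `(0, a]` at `b` and `(b, ∞)` at `a`. Both sides are then sums of the same rectangles; the
piece `(b, a] × (b, a]` occurs only in `quadInt a b` on the left. No subtraction occurs, so infinite
values are allowed. -/
lemma quadInt_add_quadInt_swap_of_le (n : ℕ) (γ θ : ℝ) {a b : ℝ} (hb : 0 < b) (hab : b ≤ a) :
    quadInt n γ θ a b + quadInt n γ θ b a = quadInt n γ θ a a + quadInt n γ θ b b +
      ∫⁻ r in uIoc b a, ∫⁻ ρ in uIoc b a, ENNReal.ofReal (radKer n γ θ r ρ) := by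
  have h1 : Ioc 0 a = Ioc 0 b ∪ Ioc b a := (Ioc_union_Ioc_eq_Ioc hb.le hab).symm
  have h2 : Ioi b = Ioc b a ∪ Ioi a := (Ioc_union_Ioi_eq_Ioi hab).symm
  have hm : Measurable fun p : ℝ × ℝ => ENNReal.ofReal (radKer n γ θ p.1 p.2) :=
    ENNReal.measurable_ofReal.comp (Measurable.radKer _ _ (by fun_prop) (by fun_prop)
      (by fun_prop))
  have hS : ∀ f : ℝ → ℝ≥0∞, ∫⁻ r in Ioc 0 a, f r =
      (∫⁻ r in Ioc 0 b, f r) + ∫⁻ r in Ioc b a, f r :=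
    fun f => by
      rw [h1, lintegral_union measurableSet_Ioc (Ioc_disjoint_Ioc_of_le le_rfl)]
  have hT : ∀ S : Set ℝ, ∫⁻ r in S, ∫⁻ ρ in Ioi b, ENNReal.ofReal (radKer n γ θ r ρ) =
      (∫⁻ r in S, ∫⁻ ρ in Ioc b a, ENNReal.ofReal (radKer n γ θ r ρ)) +
      ∫⁻ r in S, ∫⁻ ρ in Ioi a, ENNReal.ofReal (radKer n γ θ r ρ) := by
    intro S
    rw [← lintegral_add_left hm.lintegral_prod_right']
    refine lintegral_congr fun r => ?_
    rw [h2, lintegral_union measurableSet_Ioi (Ioc_disjoint_Ioi le_rfl)]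
  unfold quadInt
  rw [uIoc_of_le hab, hS, hS, hT, hT]
  ring

/-- Parametrizing the square from `b` towards `a` treats both orders of the radii at once and makes
the factor `(a - b)²` appear. -/
lemma quadInt_add_quadInt_swap (n : ℕ) (γ θ : ℝ) {a b : ℝ} (ha : 0 < a) (hb : 0 < b) :
    quadInt n γ θ a b + quadInt n γ θ b a = quadInt n γ θ a a + quadInt n γ θ b b +
      ∫⁻ p in Icc (0 : ℝ) 1, ∫⁻ q in Icc (0 : ℝ) 1, ENNReal.ofReal
        ((a - b) ^ 2 * radKer n γ θ (b + (a - b) * p) (b + (a - b) * q)) := by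
  have key : ∫⁻ r in uIoc b a, ∫⁻ ρ in uIoc b a, ENNReal.ofReal (radKer n γ θ r ρ) =
      ∫⁻ p in Icc (0 : ℝ) 1, ∫⁻ q in Icc (0 : ℝ) 1, ENNReal.ofReal
        ((a - b) ^ 2 * radKer n γ θ (b + (a - b) * p) (b + (a - b) * q)) := by
    rw [setLIntegral_uIoc_eq, ← lintegral_const_mul' _ _ ENNReal.ofReal_ne_top]
    refine lintegral_congr fun p => ?_
    rw [setLIntegral_uIoc_eq, ← lintegral_const_mul' _ _ ENNReal.ofReal_ne_top,
      ← lintegral_const_mul' _ _ ENNReal.ofReal_ne_top]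
    refine lintegral_congr fun q => ?_
    rw [← ENNReal.ofReal_mul (abs_nonneg _), ← ENNReal.ofReal_mul (abs_nonneg _), ← mul_assoc,
      abs_mul_abs_self, sq]
  rw [← key]
  rcases le_total b a with hab | hab
  · exact quadInt_add_quadInt_swap_of_le n γ θ hb hab
  · rw [uIoc_comm, add_comm (quadInt n γ θ a b), add_comm (quadInt n γ θ a a)]
    exact quadInt_add_quadInt_swap_of_le n γ θ ha hab

/-- The density `ξ ↦ ∫ quadInt` of the perimeter of the ball. -/
def ballDens (n : ℕ) (α : ℝ) (ξ : USphere n) : ℝ≥0∞ :=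
  ∫⁻ η, quadInt n (n + α) ‖(ξ : Eucl n) - (η : Eucl n)‖ 1 1 ∂(surf n)

lemma measurable_ballDens (n : ℕ) (α : ℝ) : Measurable (ballDens n α) := by
  have : Measurable fun p : USphere n × USphere n =>
      quadInt n (n + α) ‖(p.1 : Eucl n) - (p.2 : Eucl n)‖ 1 1 :=
    measurable_quadInt _ _ (by fun_prop) (by fun_prop) (by fun_prop)
  exact this.lintegral_prod_right'

/-- The perimeter is written once with `(ξ, η)` and once with the points exchanged. After
symmetrization each diagonal term involves one radius only, and scaling turns it into a power of
that radius times the density of the ball. -/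
theorem two_mul_fracPerimeter_graphSet {n : ℕ} (hn : 1 ≤ n) (α : ℝ) {u : USphere n → ℝ}
    (huc : Continuous u) (hu : ∀ x, 0 < 1 + u x) :
    2 * fracPerimeter α (graphSet u) =
      2 * (∫⁻ ξ, ENNReal.ofReal ((1 + u ξ) ^ (n - α)) * ballDens n α ξ ∂(surf n)) +
      ∫⁻ ξ, ∫⁻ η, (∫⁻ p in Icc (0 : ℝ) 1, ∫⁻ q in Icc (0 : ℝ) 1, ENNReal.ofReal
        ((u ξ - u η) ^ 2 * radKer n (n + α) ‖(ξ : Eucl n) - (η : Eucl n)‖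
          (1 + u η + (u ξ - u η) * p) (1 + u η + (u ξ - u η) * q))) ∂(surf n) ∂(surf n) := by
  have hum : Measurable u := huc.measurable
  have hm1 : Measurable fun p : USphere n × USphere n =>
      quadInt n (n + α) ‖(p.1 : Eucl n) - (p.2 : Eucl n)‖ (1 + u p.1) (1 + u p.2) :=
    measurable_quadInt _ _ (by fun_prop) (by fun_prop) (by fun_prop)
  have hm2 : Measurable fun p : USphere n × USphere n =>
      quadInt n (n + α) ‖(p.1 : Eucl n) - (p.2 : Eucl n)‖ (1 + u p.1) (1 + u p.1) :=
    measurable_quadInt _ _ (by fun_prop) (by fun_prop) (by fun_prop)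
  have hm3 : Measurable fun p : USphere n × USphere n =>
      quadInt n (n + α) ‖(p.1 : Eucl n) - (p.2 : Eucl n)‖ (1 + u p.2) (1 + u p.2) :=
    measurable_quadInt _ _ (by fun_prop) (by fun_prop) (by fun_prop)
  have hsw : fracPerimeter α (graphSet u) =
      ∫⁻ ξ, ∫⁻ η, quadInt n (n + α) ‖(ξ : Eucl n) - (η : Eucl n)‖
      (1 + u η) (1 + u ξ) ∂(surf n) ∂(surf n) := by
    rw [fracPerimeter_graphSet_eq hn α huc hu, lintegral_lintegral_swap hm1.aemeasurable]
    simp only [norm_sub_rev]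
  have hQ1 : ∫⁻ ξ, ∫⁻ η, quadInt n (n + α) ‖(ξ : Eucl n) - (η : Eucl n)‖
      (1 + u ξ) (1 + u ξ) ∂(surf n) ∂(surf n) =
      ∫⁻ ξ, ENNReal.ofReal ((1 + u ξ) ^ (n - α)) * ballDens n α ξ ∂(surf n) := by
    refine lintegral_congr fun ξ => ?_
    rw [ballDens, ← lintegral_const_mul' _ _ ENNReal.ofReal_ne_top]
    refine lintegral_congr fun η => ?_
    rw [quadInt_self_eq hn _ _ (hu ξ), show 2 * (n : ℝ) - (n + α) = n - α by ring]
  have hQ2 : ∫⁻ ξ, ∫⁻ η, quadInt n (n + α) ‖(ξ : Eucl n) - (η : Eucl n)‖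
      (1 + u η) (1 + u η) ∂(surf n) ∂(surf n) =
      ∫⁻ ξ, ENNReal.ofReal ((1 + u ξ) ^ (n - α)) * ballDens n α ξ ∂(surf n) := by
    rw [← hQ1, lintegral_lintegral_swap hm3.aemeasurable]
    simp only [norm_sub_rev]
  rw [two_mul, two_mul]
  nth_rw 1 [hsw, ← hQ1, ← hQ2]
  rw [fracPerimeter_graphSet_eq hn α huc hu, ← lintegral_prod _ hm1.aemeasurable,
    ← lintegral_prod (fun p : USphere n × USphere n =>
      quadInt n (n + α) ‖(p.1 : Eucl n) - (p.2 : Eucl n)‖ (1 + u p.2) (1 + u p.1))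
      (measurable_quadInt _ _ (by fun_prop) (by fun_prop) (by fun_prop)).aemeasurable,
    ← lintegral_prod _ hm2.aemeasurable, ← lintegral_prod _ hm3.aemeasurable,
    ← lintegral_add_right _ hm1, ← lintegral_add_right _ hm3]
  have hm4 : Measurable fun z : USphere n × USphere n =>
      (∫⁻ p in Icc (0 : ℝ) 1, ∫⁻ q in Icc (0 : ℝ) 1, ENNReal.ofReal
        ((u z.1 - u z.2) ^ 2 * radKer n (n + α) ‖(z.1 : Eucl n) - (z.2 : Eucl n)‖
          (1 + u z.2 + (u z.1 - u z.2) * p) (1 + u z.2 + (u z.1 - u z.2) * q))) := by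
    have : Measurable fun w : ((USphere n × USphere n) × ℝ) × ℝ => ENNReal.ofReal
        ((u w.1.1.1 - u w.1.1.2) ^ 2 * radKer n (n + α) ‖(w.1.1.1 : Eucl n) - (w.1.1.2 : Eucl n)‖
          (1 + u w.1.1.2 + (u w.1.1.1 - u w.1.1.2) * w.1.2)
          (1 + u w.1.1.2 + (u w.1.1.1 - u w.1.1.2) * w.2)) := by
      refine ENNReal.measurable_ofReal.comp (Measurable.mul (by fun_prop) ?_)
      exact Measurable.radKer _ _ (by fun_prop) (by fun_prop) (by fun_prop)
    exact this.lintegral_prod_right'.lintegral_prod_right'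
  rw [← lintegral_prod _ hm4.aemeasurable, ← lintegral_add_right _ hm4]
  refine lintegral_congr fun z => ?_
  rw [add_comm, quadInt_add_quadInt_swap _ _ _ (hu z.1) (hu z.2)]
  simp only [add_sub_add_left_eq_sub]

/-! ### Bounds for the perimeter density of the ball, and integrability of the model kernel. -/

lemma setLIntegral_Ioi_rpow {α : ℝ} (hα : 0 < α) {δ : ℝ} (hδ : 0 < δ) :
    ∫⁻ r in Ioi δ, ENNReal.ofReal (r ^ (-1 - α)) = ENNReal.ofReal (δ ^ (-α) / α) := by
  rw [← ofReal_integral_eq_lintegral_ofReal (integrableOn_Ioi_rpow_of_lt (by linarith) hδ),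
    integral_Ioi_rpow_of_lt (by linarith) hδ]
  · congr 1
    rw [show -1 - α + 1 = -α by ring, neg_div_neg_eq]
  · filter_upwards [ae_restrict_mem measurableSet_Ioi] with r hr
    exact Real.rpow_nonneg (hδ.trans hr).le _

lemma lintegral_inv_norm_sub_rpow {n : ℕ} (hn : 1 ≤ n) {α : ℝ} (hα : 0 < α) {δ : ℝ} (hδ : 0 < δ)
    (x : Eucl n) :
    ∫⁻ y in {y | δ ≤ ‖x - y‖}, ENNReal.ofReal (1 / ‖x - y‖ ^ ((n : ℝ) + α)) =
      surf n univ * ENNReal.ofReal (δ ^ (-α) / α) := by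
  have hS : MeasurableSet {z : Eucl n | δ ≤ ‖z‖} := measurableSet_le (by fun_prop) (by fun_prop)
  have hSx : MeasurableSet {y : Eucl n | δ ≤ ‖x - y‖} :=
    measurableSet_le (by fun_prop) (by fun_prop)
  have h1 : ∫⁻ y in {y | δ ≤ ‖x - y‖}, ENNReal.ofReal (1 / ‖x - y‖ ^ ((n : ℝ) + α)) =
      ∫⁻ z in {z : Eucl n | δ ≤ ‖z‖}, ENNReal.ofReal (1 / ‖z‖ ^ ((n : ℝ) + α)) := by
    rw [← lintegral_indicator hS, ← lintegral_indicator hSx]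
    exact lintegral_sub_left_eq_self ({z : Eucl n | δ ≤ ‖z‖}.indicator
      fun z => ENNReal.ofReal (1 / ‖z‖ ^ ((n : ℝ) + α))) x
  rw [h1, setLIntegral_polar hn (A := fun _ => Ici δ)
    (f := fun z : Eucl n => ENNReal.ofReal (1 / ‖z‖ ^ ((n : ℝ) + α))) (by fun_prop) hS
    (fun _ => Ici_subset_Ioi.2 hδ) (fun _ => measurableSet_Ici) (fun ξ r hr => by
      simp [norm_smul, abs_of_pos hr])]
  have h2 : ∀ ξ : USphere n, ∫⁻ r in Ici δ, ENNReal.ofReal (r ^ (n - 1)) *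
      ENNReal.ofReal (1 / ‖r • (ξ : Eucl n)‖ ^ ((n : ℝ) + α)) = ENNReal.ofReal (δ ^ (-α) / α) := by
    intro ξ
    rw [← setLIntegral_Ioi_rpow hα hδ, Measure.restrict_congr_set Ioi_ae_eq_Ici.symm]
    refine setLIntegral_congr_fun measurableSet_Ioi fun r hr => ?_
    have hr0 : 0 < r := hδ.trans hr
    rw [← ENNReal.ofReal_mul (by positivity), norm_smul, norm_sphere, mul_one,
      Real.norm_of_nonneg hr0.le]
    congr 1
    rw [show -1 - α = ((n - 1 : ℕ) : ℝ) - (n + α) by push_cast [Nat.cast_sub hn]; ring,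
      Real.rpow_sub hr0, Real.rpow_natCast]
    ring
  rw [lintegral_congr h2, lintegral_const, mul_comm]

lemma one_le_norm_of_notMem_graphSet_zero {n : ℕ} (hn : 1 ≤ n) {y : Eucl n}
    (hy : y ∉ graphSet (0 : USphere n → ℝ)) : 1 ≤ ‖y‖ := by
  by_contra! h
  apply hy
  rcases eq_or_ne y 0 with rfl | h0
  · have : Nonempty (Fin n) := ⟨⟨0, hn⟩⟩
    obtain ⟨x, hx⟩ := exists_norm_eq (Eucl n) (zero_le_one' ℝ)
    exact ⟨0, by simp, ⟨x, by simpa using hx⟩, by simp⟩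
  · refine ⟨‖y‖, ⟨norm_nonneg _, h.le⟩, radialProj y h0, ?_⟩
    simp [radialProj, smul_smul, norm_ne_zero_iff.2 h0]

lemma setLIntegral_one_sub_rpow_lt_top {α : ℝ} (hα1 : α < 1) :
    ∫⁻ r in Ioc (0 : ℝ) 1, ENNReal.ofReal ((1 - r) ^ (-α) / α) < ⊤ := by
  have h : IntervalIntegrable (fun r : ℝ => (1 - r) ^ (-α)) volume 0 1 := by
    have := (intervalIntegral.intervalIntegrable_rpow' (a := 0) (b := 1)
      (show -1 < -α by linarith)).comp_sub_left 1
    simpa using this.symm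
  exact ((intervalIntegrable_iff_integrableOn_Ioc_of_le zero_le_one).1 h).div_const α
    |>.lintegral_lt_top

/-- For `|x| = r < 1` the complement of the ball lies at distance at least `1 - r` from `x`, so the
inner integral is at most a constant times `(1 - r)^(-α)`. This is integrable at `r = 1` because `α
< 1`. -/
lemma exists_ballDens_le {n : ℕ} (hn : 1 ≤ n) {α : ℝ} (hα : 0 < α) (hα1 : α < 1) :
    ∃ C : ℝ, ∀ ξ : USphere n, ballDens n α ξ ≤ ENNReal.ofReal C := by
  have hfin : surf n univ * ∫⁻ r in Ioc (0 : ℝ) 1, ENNReal.ofReal ((1 - r) ^ (-α) / α) ≠ ⊤ :=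
    ENNReal.mul_ne_top (measure_ne_top _ _) (setLIntegral_one_sub_rpow_lt_top hα1).ne
  refine ⟨_, fun ξ => le_trans ?_ (ENNReal.ofReal_toReal hfin).ge⟩
  have h0 : ∀ x : USphere n, 0 < 1 + (0 : USphere n → ℝ) x := fun x => by simp
  -- The endpoint `r = 1`, where the distance bound `1 - r` degenerates, is removed as a null set.
  rw [ballDens, lintegral_quadInt (n + α) (b := fun _ => 1) measurable_const,
    ← lintegral_const_mul' _ _ (measure_ne_top _ _),
    Measure.restrict_congr_set Ioo_ae_eq_Ioc.symm]
  refine setLIntegral_mono_ae' measurableSet_Ioo (Eventually.of_forall fun r hr => ?_)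
  have h1 := ofReal_mul_setLIntegral_compl_graphSet hn α continuous_zero h0 ξ hr.1
  simp only [Pi.zero_apply, add_zero] at h1
  rw [← h1, ← lintegral_inv_norm_sub_rpow hn hα (sub_pos.2 hr.2) (r • (ξ : Eucl n)),
    ← one_mul (∫⁻ y in {y | 1 - r ≤ ‖r • (ξ : Eucl n) - y‖}, _)]
  gcongr
  · rw [← ENNReal.ofReal_one]
    exact ENNReal.ofReal_le_ofReal (pow_le_one₀ hr.1.le hr.2.le)
  · intro y hy
    have h3 := one_le_norm_of_notMem_graphSet_zero hn hy
    have h4 := norm_sub_norm_le y (r • (ξ : Eucl n))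
    rw [norm_sub_rev, norm_smul, norm_sphere, mul_one, Real.norm_of_nonneg hr.1.le] at h4
    simp only [mem_ofPred_eq]
    linarith

lemma quadInt_one_one_pos (n : ℕ) (γ θ : ℝ) : 0 < quadInt n γ θ 1 1 := by
  have hm : Measurable fun p : ℝ × ℝ => ENNReal.ofReal (radKer n γ θ p.1 p.2) :=
    ENNReal.measurable_ofReal.comp (Measurable.radKer _ _ (by fun_prop) (by fun_prop)
      (by fun_prop))
  unfold quadInt
  rw [setLIntegral_pos_iff hm.lintegral_prod_right']
  have : Ioc (0 : ℝ) 1 ⊆ Function.support (fun r =>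
      ∫⁻ ρ in Ioi (1 : ℝ), ENNReal.ofReal (radKer n γ θ r ρ)) := by
    intro r hr
    have hmr : Measurable fun ρ => ENNReal.ofReal (radKer n γ θ r ρ) := by
      exact hm.comp (measurable_const.prodMk measurable_id)
    rw [Function.mem_support, ← pos_iff_ne_zero, setLIntegral_pos_iff hmr]
    have : Ioi (1 : ℝ) ⊆ Function.support fun ρ => ENNReal.ofReal (radKer n γ θ r ρ) := by
      intro ρ hρ
      have h1 : 0 < ρ := zero_lt_one.trans hρ
      have h2 : 0 < r := hr.1
      have h3 : 0 < (r - ρ) ^ 2 := by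
        have : r - ρ < 0 := by have := hr.2; have : 1 < ρ := hρ; linarith
        exact even_two.pow_pos this.ne
      rw [Function.mem_support, ← pos_iff_ne_zero, ENNReal.ofReal_pos]
      have h4 : 0 < (r - ρ) ^ 2 + r * ρ * θ ^ 2 := add_pos_of_pos_of_nonneg h3 (by positivity)
      exact div_pos (by positivity) (Real.rpow_pos_of_pos h4 _)
    rw [inter_eq_right.2 this]
    simp
  rw [inter_eq_right.2 this]
  simp

lemma surf_univ_ne_zero {n : ℕ} (hn : 1 ≤ n) : surf n univ ≠ 0 := by
  have : Nonempty (Fin n) := ⟨⟨0, hn⟩⟩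
  rw [surf, Ne, Measure.measure_univ_eq_zero]
  exact Measure.toSphere_ne_zero _

lemma ballDens_pos {n : ℕ} (hn : 1 ≤ n) (α : ℝ) (ξ : USphere n) : 0 < ballDens n α ξ := by
  have hm : Measurable fun η : USphere n => quadInt n (n + α) ‖(ξ : Eucl n) - (η : Eucl n)‖ 1 1 :=
    measurable_quadInt _ _ (by fun_prop) (by fun_prop) (by fun_prop)
  rw [ballDens, lintegral_pos_iff_support hm]
  have : Function.support (fun η : USphere n =>
      quadInt n (n + α) ‖(ξ : Eucl n) - (η : Eucl n)‖ 1 1) = univ :=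
    eq_univ_of_forall fun η => (quadInt_one_one_pos _ _ _).ne'
  rw [this]
  exact pos_iff_ne_zero.2 (surf_univ_ne_zero hn)

/-- On the square of side `θ / 4` with a corner at `(1, 1)` both radii are at least `1/2` and the
two points are at distance at most `2 θ`, which bounds the kernel below; multiply by the area. -/
lemma le_quadInt_one_one (n : ℕ) {γ θ : ℝ} (hγ : 0 ≤ γ) (h0 : 0 < θ) (h2 : θ ≤ 2) :
    ENNReal.ofReal ((θ / 4) ^ 2 * ((1 / 2) ^ (n - 1) / (2 * θ) ^ γ)) ≤ quadInt n γ θ 1 1 := by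
  have hk : ∀ r ∈ Ioc (1 - θ / 4) 1, ∀ ρ ∈ Ioc 1 (1 + θ / 4),
      ENNReal.ofReal ((1 / 2) ^ (n - 1) / (2 * θ) ^ γ) ≤ ENNReal.ofReal (radKer n γ θ r ρ) := by
    intro r hr ρ hρ
    apply ENNReal.ofReal_le_ofReal
    have hr1 : 1 / 2 ≤ r := by linarith [hr.1]
    have hr0 : 0 < r := by linarith
    have hρ0 : 0 < ρ := by linarith [hρ.1]
    have hne : 0 < (r - ρ) ^ 2 + r * ρ * θ ^ 2 := by positivity
    unfold radKer
    have hden : ((r - ρ) ^ 2 + r * ρ * θ ^ 2) ^ (γ / 2) ≤ (2 * θ) ^ γ := by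
      have : (2 * θ) ^ γ = ((2 * θ) ^ 2) ^ (γ / 2) := by
        rw [← Real.rpow_natCast, ← Real.rpow_mul (by positivity)]; congr 1; push_cast; ring
      rw [this]
      apply Real.rpow_le_rpow hne.le _ (by positivity)
      have h5 : r * ρ ≤ 3 / 2 := by nlinarith [hr.2, hρ.2]
      have h6 : (r - ρ) ^ 2 ≤ (θ / 2) ^ 2 := sq_le_sq' (by linarith [hr.1, hρ.2])
        (by linarith [hr.2, hρ.1])
      nlinarith [mul_le_mul_of_nonneg_right h5 (sq_nonneg θ), sq_nonneg θ]
    have hnum : (1 / 2 : ℝ) ^ (n - 1) ≤ r ^ (n - 1) * ρ ^ (n - 1) := by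
      rw [← mul_pow]
      exact pow_le_pow_left₀ (by norm_num) (by nlinarith [hρ.1]) _
    exact div_le_div₀ (by positivity) hnum (by positivity) hden
  have hS : Ioc (1 - θ / 4) 1 ⊆ Ioc (0 : ℝ) 1 := Ioc_subset_Ioc_left (by linarith)
  have hT : Ioc 1 (1 + θ / 4) ⊆ Ioi (1 : ℝ) := Ioc_subset_Ioi_self
  calc ENNReal.ofReal ((θ / 4) ^ 2 * ((1 / 2) ^ (n - 1) / (2 * θ) ^ γ))
      = ∫⁻ r in Ioc (1 - θ / 4) 1, ∫⁻ ρ in Ioc 1 (1 + θ / 4),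
          ENNReal.ofReal ((1 / 2) ^ (n - 1) / (2 * θ) ^ γ) := by
        simp only [setLIntegral_const, Real.volume_Ioc]
        rw [← ENNReal.ofReal_mul (by positivity), ← ENNReal.ofReal_mul (by
          rw [add_sub_cancel_left]; positivity)]
        congr 1; ring
    _ ≤ ∫⁻ r in Ioc (1 - θ / 4) 1, ∫⁻ ρ in Ioi 1, ENNReal.ofReal (radKer n γ θ r ρ) := by
        refine setLIntegral_mono_ae' measurableSet_Ioc (Eventually.of_forall fun r hr => ?_)
        exact (setLIntegral_mono_ae' measurableSet_Ioc (Eventually.of_forall fun ρ hρ =>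
          hk r hr ρ hρ)).trans (lintegral_mono_set hT)
    _ ≤ _ := lintegral_mono_set hS

lemma norm_sub_sphere_le_two {n : ℕ} (ξ η : USphere n) : ‖(ξ : Eucl n) - (η : Eucl n)‖ ≤ 2 := by
  have := norm_sub_le (ξ : Eucl n) (η : Eucl n)
  rw [norm_sphere, norm_sphere] at this
  linarith

lemma ofReal_sq_div_rpow_le (n : ℕ) {γ θ : ℝ} (hγ : 0 ≤ γ) (h0 : 0 ≤ θ) (h2 : θ ≤ 2) :
    ENNReal.ofReal (θ ^ 2 / θ ^ γ) ≤
      ENNReal.ofReal (16 * 2 ^ (n - 1) * 2 ^ γ) * quadInt n γ θ 1 1 := by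
  rcases h0.eq_or_lt with rfl | h0
  · simp
  refine le_trans (le_of_eq ?_) (mul_le_mul_right (le_quadInt_one_one n hγ h0 h2) _)
  rw [← ENNReal.ofReal_mul (by positivity)]
  congr 1
  rw [Real.mul_rpow zero_le_two h0.le]
  have : θ ^ γ ≠ 0 := (Real.rpow_pos_of_pos h0 _).ne'
  have : (2 : ℝ) ^ γ ≠ 0 := (Real.rpow_pos_of_pos two_pos _).ne'
  rw [one_div, inv_pow]
  field_simp
  norm_num

/-- No direct computation on the sphere is needed: the integrand is at most a constant times
`quadInt` at radii `1, 1`, whose double integral is that of the bounded density of the ball. -/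
lemma integrable_sq_div_rpow {n : ℕ} (hn : 1 ≤ n) {α : ℝ} (hα : 0 < α) (hα1 : α < 1) :
    Integrable (fun p : USphere n × USphere n => ‖(p.1 : Eucl n) - (p.2 : Eucl n)‖ ^ 2 /
      ‖(p.1 : Eucl n) - (p.2 : Eucl n)‖ ^ ((n : ℝ) + α)) ((surf n).prod (surf n)) := by
  refine ⟨Measurable.aestronglyMeasurable (by fun_prop), ?_⟩
  rw [hasFiniteIntegral_iff_ofReal (Eventually.of_forall fun p => by positivity)]
  obtain ⟨C, hC⟩ := exists_ballDens_le (n := n) hn hα hα1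
  have hm : Measurable fun p : USphere n × USphere n =>
      quadInt n (n + α) ‖(p.1 : Eucl n) - (p.2 : Eucl n)‖ 1 1 :=
    measurable_quadInt _ _ (by fun_prop) (by fun_prop) (by fun_prop)
  calc _ ≤ ∫⁻ p : USphere n × USphere n, ENNReal.ofReal (16 * 2 ^ (n - 1) * 2 ^ (n + α)) *
        quadInt n (n + α) ‖(p.1 : Eucl n) - (p.2 : Eucl n)‖ 1 1 ∂((surf n).prod (surf n)) :=
        lintegral_mono fun p => ofReal_sq_div_rpow_le n (by positivity) (norm_nonneg _)
          (norm_sub_sphere_le_two _ _)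
    _ = ENNReal.ofReal (16 * 2 ^ (n - 1) * 2 ^ (n + α)) * ∫⁻ ξ, ballDens n α ξ ∂(surf n) := by
        rw [lintegral_const_mul _ hm, lintegral_prod _ hm.aemeasurable]
        rfl
    _ ≤ ENNReal.ofReal (16 * 2 ^ (n - 1) * 2 ^ (n + α)) * ∫⁻ ξ, ENNReal.ofReal C ∂(surf n) := by
        gcongr; exact hC _
    _ < ⊤ := by
        rw [lintegral_const]
        exact ENNReal.mul_lt_top ENNReal.ofReal_lt_top
          (ENNReal.mul_lt_top ENNReal.ofReal_lt_top (measure_lt_top _ _))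

/-! ### The smooth factor of the kernel and its derivatives in `l`. -/

/-- The partial derivative of a function of `(l, z)` in the first variable. -/
def pderiv {E : Type*} [NormedAddCommGroup E] [NormedSpace ℝ E] (F : ℝ × E → ℝ) (x : ℝ × E) : ℝ :=
  fderiv ℝ F x (1, 0)

section pderiv

variable {E : Type*} [NormedAddCommGroup E] [NormedSpace ℝ E]

lemma hasDerivAt_pderiv {F : ℝ × E → ℝ} {l : ℝ} {z : E} (h : DifferentiableAt ℝ F (l, z)) :
    HasDerivAt (fun l => F (l, z)) (pderiv F (l, z)) l := by
  have h1 : HasDerivAt (fun l : ℝ => (l, z)) ((1 : ℝ), (0 : E)) l :=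
    (hasDerivAt_id l).prodMk (hasDerivAt_const l z)
  exact h.hasFDerivAt.comp_hasDerivAt l h1

lemma ContDiffOn.pderiv {F : ℝ × E → ℝ} {U : Set (ℝ × E)} (hU : IsOpen U) {m k : ℕ}
    (hmk : m + 1 ≤ k) (h : ContDiffOn ℝ k F U) : ContDiffOn ℝ m (pderiv F) U :=
  (h.fderiv_of_isOpen hU (by exact_mod_cast hmk)).clm_apply contDiffOn_const

/-- Uniform bounds on the first two derivatives in `l` of a smooth function `F (l, z)` such that
`F (l, 0) = l²`. -/
lemma exists_bound_pderiv [FiniteDimensional ℝ E] {F : ℝ × E → ℝ} {U : Set (ℝ × E)}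
    (hU : IsOpen U) (hF : ContDiffOn ℝ 3 F U) {T : Set ℝ} (hT : IsCompact T) {K : Set E}
    (hK : IsCompact K) (hKc : Convex ℝ K) (hTK : T ×ˢ K ⊆ U) (h0 : (0 : E) ∈ K)
    (h1T : Icc (0 : ℝ) 1 ⊆ T) (hz : ∀ l, F (l, 0) = l ^ 2)
    (hUz : ∀ l ∈ Icc (0 : ℝ) 1, ∀ᶠ l' in 𝓝 l, (l', (0 : E)) ∈ U) :
    ∃ C : ℝ, 0 ≤ C ∧ (∀ l ∈ T, ∀ z ∈ K, |F (l, z)| ≤ C ∧ |pderiv F (l, z)| ≤ C ∧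
      |pderiv (pderiv F) (l, z)| ≤ C) ∧
      ∀ z ∈ K, |pderiv (pderiv F) (1, z) - pderiv (pderiv F) (0, z)| ≤ C * ‖z‖ := by
  have hF1 : ContDiffOn ℝ (2 : ℕ) (pderiv F) U := ContDiffOn.pderiv hU (k := 3) (by norm_num) hF
  have hF2 : ContDiffOn ℝ (1 : ℕ) (pderiv (pderiv F)) U :=
    ContDiffOn.pderiv hU (k := 2) (by norm_num) hF1
  have hcpt : IsCompact (T ×ˢ K) := hT.prod hK
  obtain ⟨C0, hC0⟩ := hcpt.exists_bound_of_continuousOn (hF.continuousOn.mono hTK)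
  obtain ⟨C1, hC1⟩ := hcpt.exists_bound_of_continuousOn (hF1.continuousOn.mono hTK)
  obtain ⟨C2, hC2⟩ := hcpt.exists_bound_of_continuousOn (hF2.continuousOn.mono hTK)
  have hmaps : ∀ l ∈ Icc (0 : ℝ) 1, MapsTo (fun z : E => (l, z)) K U :=
    fun l hl z hzK => hTK ⟨h1T hl, hzK⟩
  have hR : ContDiffOn ℝ (1 : ℕ)
      (fun z : E => pderiv (pderiv F) (1, z) - pderiv (pderiv F) (0, z)) K :=
    ContDiffOn.sub
      (hF2.comp (contDiff_prodMk_right 1).contDiffOn (hmaps 1 (by simp)))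
      (hF2.comp (contDiff_prodMk_right 0).contDiffOn (hmaps 0 (by simp)))
  obtain ⟨L, hL⟩ := hR.exists_lipschitzOnWith (by simp) hKc hK
  -- Differentiating `F (l, 0) = l²` twice gives the value `2` at both `l = 0` and `l = 1`. The
  -- difference of second derivatives thus vanishes at `z = 0`, and its Lipschitz bound on the
  -- compact convex set `K` becomes a multiple of `‖z‖`.
  have hd1 : ∀ l, (l, (0 : E)) ∈ U → pderiv F (l, 0) = 2 * l := by
    intro l hl
    have h1 := hasDerivAt_pderiv ((hF.contDiffAt (hU.mem_nhds hl)).differentiableAt (by norm_num))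
    simp only [hz] at h1
    rw [h1.unique (by simpa using hasDerivAt_pow 2 l)]
  have hd2 : ∀ l ∈ Icc (0 : ℝ) 1, pderiv (pderiv F) (l, 0) = 2 := by
    intro l hl
    have hlU : (l, (0 : E)) ∈ U := hTK ⟨h1T hl, h0⟩
    have h1 := hasDerivAt_pderiv ((hF1.contDiffAt (hU.mem_nhds hlU)).differentiableAt (by norm_num))
    have h2 : HasDerivAt (fun l : ℝ => 2 * l) 2 l := by
      simpa using (hasDerivAt_id l).const_mul 2
    exact h1.unique (h2.congr_of_eventuallyEq ((hUz l hl).mono fun l' hl' => hd1 l' hl'))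
  refine ⟨max (max C0 C1) (max C2 L), le_max_of_le_right (le_max_of_le_right L.2),
    fun l hl z hzK => ⟨?_, ?_, ?_⟩, fun z hzK => ?_⟩
  · exact (hC0 (l, z) ⟨hl, hzK⟩).trans ((le_max_left _ _).trans (le_max_left _ _))
  · exact (hC1 (l, z) ⟨hl, hzK⟩).trans ((le_max_right _ _).trans (le_max_left _ _))
  · exact (hC2 (l, z) ⟨hl, hzK⟩).trans ((le_max_left _ _).trans (le_max_right _ _))
  · have h1 := hL.dist_le_mul z hzK 0 h0
    rw [hd2 1 (by simp), hd2 0 (by simp), sub_self, dist_zero_right, dist_zero_right] at h1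
    exact h1.trans (mul_le_mul_of_nonneg_right
      ((le_max_right _ _).trans (le_max_right _ _)) (norm_nonneg _))

end pderiv

/-- The smooth factor of the radial kernel along the rescaling `l ↦ l • u`. -/
def smoothKer (n : ℕ) (γ : ℝ) (x : ℝ × ℝ × ℝ × ℝ) : ℝ :=
  x.1 ^ 2 * (((1 + x.1 * x.2.1) * (1 + x.1 * x.2.2.1)) ^ (n - 1) *
    (x.1 ^ 2 * x.2.2.2 ^ 2 + (1 + x.1 * x.2.1) * (1 + x.1 * x.2.2.1)) ^ (-(γ / 2)))

/-- The domain of smoothness of `smoothKer`. -/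
def smoothDom : Set (ℝ × ℝ × ℝ × ℝ) := {x | 0 < 1 + x.1 * x.2.1 ∧ 0 < 1 + x.1 * x.2.2.1}

/-- The range of the parameters of `smoothKer`. -/
def parBox : Set (ℝ × ℝ × ℝ) := Icc (-(1 / 2)) (1 / 2) ×ˢ Icc (-(1 / 2)) (1 / 2) ×ˢ Icc (-1) 1

lemma measurable_smoothKer (n : ℕ) (γ : ℝ) : Measurable (smoothKer n γ) := by
  unfold smoothKer; fun_prop

lemma measurable_pderiv (F : ℝ × ℝ × ℝ × ℝ → ℝ) : Measurable (pderiv F) :=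
  measurable_fderiv_apply_const ℝ F _

lemma isOpen_smoothDom : IsOpen smoothDom := by
  have h1 : IsOpen {x : ℝ × ℝ × ℝ × ℝ | 0 < 1 + x.1 * x.2.1} :=
    isOpen_lt (by fun_prop) (by fun_prop)
  have h2 : IsOpen {x : ℝ × ℝ × ℝ × ℝ | 0 < 1 + x.1 * x.2.2.1} :=
    isOpen_lt (by fun_prop) (by fun_prop)
  exact h1.inter h2

lemma contDiffOn_smoothKer (n : ℕ) (γ : ℝ) (k : ℕ) :
    ContDiffOn ℝ k (smoothKer n γ) smoothDom := by
  unfold smoothKer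
  refine ContDiffOn.mul (by fun_prop) (ContDiffOn.mul (by fun_prop) ?_)
  refine ContDiffOn.rpow_const_of_ne (by fun_prop) fun x hx => ?_
  have := mul_pos hx.1 hx.2
  positivity

/-- The interval `[-3/2, 3/2]` has `[0, 1]` in its interior, so two-sided derivatives make sense at
both ends, and is short enough to keep `1 + l v` away from zero: `1 - 3/2 · 1/2 = 1/4`. -/
lemma one_add_mul_pos_of_abs_le {l v : ℝ} (hl : l ∈ Icc (-(3 / 2) : ℝ) (3 / 2))
    (hv : v ∈ Icc (-(1 / 2) : ℝ) (1 / 2)) : 1 / 4 ≤ 1 + l * v := by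
  have h1 : |l * v| ≤ 3 / 2 * (1 / 2) := by
    rw [abs_mul]
    exact mul_le_mul (abs_le.2 hl) (abs_le.2 hv) (abs_nonneg _) (by norm_num)
  have := (abs_le.1 h1).1
  linarith

lemma prod_parBox_subset_smoothDom : Icc (-(3 / 2) : ℝ) (3 / 2) ×ˢ parBox ⊆ smoothDom := by
  rintro ⟨l, v, v', w⟩ ⟨hl, hv, hv', _⟩
  exact ⟨by have := one_add_mul_pos_of_abs_le hl hv; simp only at *; linarith,
    by have := one_add_mul_pos_of_abs_le hl hv'; simp only at *; linarith⟩

lemma isCompact_parBox : IsCompact parBox := isCompact_Icc.prod (isCompact_Icc.prod isCompact_Icc)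

lemma convex_parBox : Convex ℝ parBox :=
  (convex_Icc _ _).prod ((convex_Icc _ _).prod (convex_Icc _ _))

lemma exists_bound_smoothKer (n : ℕ) (γ : ℝ) :
    ∃ C : ℝ, 0 ≤ C ∧ (∀ l ∈ Icc (-(3 / 2) : ℝ) (3 / 2), ∀ z ∈ parBox, |smoothKer n γ (l, z)| ≤ C ∧
      |pderiv (smoothKer n γ) (l, z)| ≤ C ∧ |pderiv (pderiv (smoothKer n γ)) (l, z)| ≤ C) ∧
      ∀ z ∈ parBox, |pderiv (pderiv (smoothKer n γ)) (1, z) -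
        pderiv (pderiv (smoothKer n γ)) (0, z)| ≤ C * ‖z‖ := by
  refine exists_bound_pderiv isOpen_smoothDom (contDiffOn_smoothKer n γ 3) isCompact_Icc
    isCompact_parBox convex_parBox prod_parBox_subset_smoothDom ?_
    (Icc_subset_Icc (by norm_num) (by norm_num)) (fun l => ?_) (fun l _ => ?_)
  · simp only [parBox, mem_prod, mem_Icc, Prod.fst_zero, Prod.snd_zero]
    norm_num
  · simp [smoothKer]
  · exact Eventually.of_forall fun l' => by simp [smoothDom]

lemma hasDerivAt_smoothKer (n : ℕ) (γ : ℝ) {l : ℝ} (hl : l ∈ Ioo (-(3 / 2) : ℝ) (3 / 2))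
    {z : ℝ × ℝ × ℝ} (hz : z ∈ parBox) :
    HasDerivAt (fun l => smoothKer n γ (l, z)) (pderiv (smoothKer n γ) (l, z)) l ∧
    HasDerivAt (fun l => pderiv (smoothKer n γ) (l, z))
      (pderiv (pderiv (smoothKer n γ)) (l, z)) l := by
  have hm : (l, z) ∈ smoothDom := prod_parBox_subset_smoothDom ⟨Ioo_subset_Icc_self hl, hz⟩
  have hn := isOpen_smoothDom.mem_nhds hm
  exact ⟨hasDerivAt_pderiv (((contDiffOn_smoothKer n γ 1).contDiffAt hn).differentiableAt
      (by norm_num)),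
    hasDerivAt_pderiv (((ContDiffOn.pderiv isOpen_smoothDom (m := 1) (k := 2) (by norm_num)
      (contDiffOn_smoothKer n γ 2)).contDiffAt hn).differentiableAt (by norm_num))⟩

/-- The difference of the two radii is `l (a - b) (p - q)`, so `θ²` factors out of the base of the
denominator and leaves a quantity depending only on the slope `(a - b) / θ`. Its power `θ^γ` is the
Gagliardo denominator. -/
lemma sq_mul_radKer_eq (n : ℕ) {γ θ l a b p q : ℝ} (hθ : 0 ≤ θ) (hab : θ = 0 → a = b)
    (h1 : 0 < 1 + l * (b + (a - b) * p)) (h2 : 0 < 1 + l * (b + (a - b) * q)) :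
    (l * a - l * b) ^ 2 * radKer n γ θ (1 + l * b + (l * a - l * b) * p)
      (1 + l * b + (l * a - l * b) * q) =
    (a - b) ^ 2 / θ ^ γ * smoothKer n γ
      (l, b + (a - b) * p, b + (a - b) * q, (p - q) * ((a - b) / θ)) := by
  -- On the diagonal of the sphere `a = b`, and both sides vanish.
  rcases hθ.eq_or_lt with rfl | hθ
  · simp [hab rfl]
  have e1 : 1 + l * b + (l * a - l * b) * p = 1 + l * (b + (a - b) * p) := by ring
  have e2 : 1 + l * b + (l * a - l * b) * q = 1 + l * (b + (a - b) * q) := by ring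
  rw [e1, e2]
  unfold smoothKer radKer
  simp only
  set A := 1 + l * (b + (a - b) * p) with hA
  set B := 1 + l * (b + (a - b) * q) with hB
  have e3 : (A - B) ^ 2 + A * B * θ ^ 2 =
      θ ^ 2 * (l ^ 2 * ((p - q) * ((a - b) / θ)) ^ 2 + A * B) := by
    have : A - B = l * (a - b) * (p - q) := by rw [hA, hB]; ring
    rw [this]; field_simp
  have hpos : 0 < l ^ 2 * ((p - q) * ((a - b) / θ)) ^ 2 + A * B :=
    add_pos_of_nonneg_of_pos (by positivity) (mul_pos h1 h2)
  have e4 : (θ ^ 2) ^ (γ / 2) = θ ^ γ := by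
    rw [← Real.rpow_natCast, ← Real.rpow_mul hθ.le]; congr 1; push_cast; ring
  rw [e3, Real.mul_rpow (by positivity) hpos.le, e4, Real.rpow_neg hpos.le, mul_pow A B]
  have : θ ^ γ ≠ 0 := (Real.rpow_pos_of_pos hθ _).ne'
  have := (Real.rpow_pos_of_pos hpos (γ / 2)).ne'
  field_simp

/-! ### Differentiation in `l` of the two integrals composing the perimeter. -/

/-- `u` is bounded by `ε ≤ 1/2` and Lipschitz with constant `2 ε` for the chordal distance. -/
structure LipBound {n : ℕ} (u : USphere n → ℝ) (ε : ℝ) : Prop where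
  cont : Continuous u
  nonneg : 0 ≤ ε
  le_half : ε ≤ 1 / 2
  abs_le : ∀ x, |u x| ≤ ε
  lip : ∀ x y, |u x - u y| ≤ 2 * ε * ‖(x : Eucl n) - (y : Eucl n)‖

lemma LipBound.mem_Icc {n : ℕ} {u : USphere n → ℝ} {ε : ℝ} (h : LipBound u ε) (x : USphere n) :
    u x ∈ Icc (-(1 / 2) : ℝ) (1 / 2) :=
  _root_.abs_le.1 ((h.abs_le x).trans h.le_half)

lemma one_add_mul_mem_Icc {l v : ℝ} (hl : l ∈ Icc (-(3 / 2) : ℝ) (3 / 2))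
    (hv : v ∈ Icc (-(1 / 2) : ℝ) (1 / 2)) : 1 + l * v ∈ Icc (1 / 4 : ℝ) (7 / 4) := by
  have h1 := one_add_mul_pos_of_abs_le hl hv
  have h2 := one_add_mul_pos_of_abs_le (l := -l) ⟨by linarith [hl.2], by linarith [hl.1]⟩ hv
  exact ⟨h1, by linarith⟩

lemma exists_bound_rpow (m : ℝ) : ∃ C : ℝ, 0 ≤ C ∧ (∀ x ∈ Icc (1 / 4 : ℝ) (7 / 4), |x ^ m| ≤ C) ∧
    ∀ x ∈ Icc (1 / 4 : ℝ) (7 / 4), ∀ y ∈ Icc (1 / 4 : ℝ) (7 / 4), |x ^ m - y ^ m| ≤ C * |x - y| := by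
  have hc : ContDiffOn ℝ 1 (fun x : ℝ => x ^ m) (Icc (1 / 4 : ℝ) (7 / 4)) :=
    contDiffOn_id.rpow_const_of_ne fun x hx => by
      have := hx.1
      simp only [id]
      intro h0
      linarith
  obtain ⟨C, hC⟩ := isCompact_Icc.exists_bound_of_continuousOn hc.continuousOn
  obtain ⟨L, hL⟩ := hc.exists_lipschitzOnWith one_ne_zero (convex_Icc _ _) isCompact_Icc
  refine ⟨max C L, le_max_of_le_right L.2, fun x hx => (hC x hx).trans (le_max_left _ _),
    fun x hx y hy => (hL.dist_le_mul x hx y hy).trans ?_⟩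
  exact mul_le_mul_of_nonneg_right (le_max_right _ _) dist_nonneg

/-- The integral of `(1 + l u)^m g` over the sphere. -/
def rpowInt {n : ℕ} (m : ℝ) (g u : USphere n → ℝ) (l : ℝ) : ℝ :=
  ∫ ξ, (1 + l * u ξ) ^ m * g ξ ∂(surf n)

section rpowInt

variable {n : ℕ} {u g : USphere n → ℝ} {ε : ℝ}

lemma integrable_rpowInt (hu : LipBound u ε) (hg : Integrable g (surf n)) (m : ℝ) {l : ℝ}
    (hl : l ∈ Icc (-(3 / 2) : ℝ) (3 / 2)) :
    Integrable (fun ξ => (1 + l * u ξ) ^ m * g ξ) (surf n) := by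
  obtain ⟨C, -, hC, -⟩ := exists_bound_rpow m
  have hum := hu.cont.measurable
  refine hg.bdd_mul (c := C) (Measurable.aestronglyMeasurable (by fun_prop)) ?_
  exact Eventually.of_forall fun ξ => hC _ (one_add_mul_mem_Icc hl (hu.mem_Icc ξ))

lemma LipBound.integrable_mul (hu : LipBound u ε) (hg : Integrable g (surf n)) (m : ℝ) :
    Integrable (fun ξ => m * u ξ * g ξ) (surf n) := by
  have hum := hu.cont.measurable
  refine hg.bdd_mul (c := |m| * ε) (Measurable.aestronglyMeasurable (by fun_prop))
    (Eventually.of_forall fun ξ => ?_)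
  rw [Real.norm_eq_abs, abs_mul]
  exact mul_le_mul_of_nonneg_left (hu.abs_le ξ) (abs_nonneg _)

/-- The derivative is again a `rpowInt`, with exponent `m - 1` and density `m u g`, so the statement
can be iterated for the second derivative. -/
lemma hasDerivAt_rpowInt (hu : LipBound u ε) (hg : Integrable g (surf n)) (m : ℝ) {l : ℝ}
    (hl : l ∈ Ioo (-(3 / 2) : ℝ) (3 / 2)) :
    HasDerivAt (rpowInt m g u) (rpowInt (m - 1) (fun ξ => m * u ξ * g ξ) u l) l := by
  obtain ⟨C, hC0, hC, -⟩ := exists_bound_rpow (m - 1)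
  have hg' := hu.integrable_mul hg m
  refine (hasDerivAt_integral_of_dominated_loc_of_deriv_le (μ := surf n)
    (s := Ioo (-(3 / 2) : ℝ) (3 / 2)) (bound := fun ξ => C * |m * u ξ * g ξ|)
    (F := fun l ξ => (1 + l * u ξ) ^ m * g ξ)
    (F' := fun l ξ => (1 + l * u ξ) ^ (m - 1) * (m * u ξ * g ξ))
    (isOpen_Ioo.mem_nhds hl) ?_ ?_ ?_ ?_ ?_ ?_).2
  · filter_upwards [isOpen_Ioo.mem_nhds hl] with l' hl'
    exact (integrable_rpowInt hu hg m (Ioo_subset_Icc_self hl')).aestronglyMeasurable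
  · exact integrable_rpowInt hu hg m (Ioo_subset_Icc_self hl)
  · exact (integrable_rpowInt hu hg' (m - 1) (Ioo_subset_Icc_self hl)).aestronglyMeasurable
  · refine Eventually.of_forall fun ξ l' hl' => ?_
    rw [norm_mul]
    exact mul_le_mul_of_nonneg_right
      (hC _ (one_add_mul_mem_Icc (Ioo_subset_Icc_self hl') (hu.mem_Icc ξ))) (norm_nonneg _)
  · exact hg'.abs.const_mul C
  · refine Eventually.of_forall fun ξ l' hl' => ?_
    have h1 : HasDerivAt (fun l => 1 + l * u ξ) (u ξ) l' := by
      simpa using ((hasDerivAt_id l').mul_const (u ξ)).const_add 1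
    have h2 := (one_add_mul_mem_Icc (Ioo_subset_Icc_self hl') (hu.mem_Icc ξ)).1
    have h3 := (h1.rpow_const (p := m) (Or.inl (by linarith))).mul_const (g ξ)
    exact h3.congr_deriv (by ring)

/-- The constant depends on neither `u` nor `g`. The factor `ε` in the second bound is the Lipschitz
estimate for `x ↦ x^m` between `1 + u` and `1`. -/
lemma exists_bound_rpowInt (n : ℕ) (m : ℝ) : ∃ C : ℝ, 0 ≤ C ∧ ∀ (u g : USphere n → ℝ) (ε : ℝ),
    LipBound u ε → Integrable g (surf n) →
    (∀ l ∈ Icc (-(3 / 2) : ℝ) (3 / 2), |rpowInt m g u l| ≤ C * ∫ ξ, |g ξ| ∂(surf n)) ∧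
    |rpowInt m g u 1 - rpowInt m g u 0| ≤ C * ε * ∫ ξ, |g ξ| ∂(surf n) := by
  obtain ⟨C, hC0, hC, hC'⟩ := exists_bound_rpow m
  refine ⟨C, hC0, fun u g ε hu hg => ⟨fun l hl => ?_, ?_⟩⟩
  · rw [← integral_const_mul, ← Real.norm_eq_abs]
    refine norm_integral_le_of_norm_le (hg.abs.const_mul C) (Eventually.of_forall fun ξ => ?_)
    rw [norm_mul]
    exact mul_le_mul_of_nonneg_right (hC _ (one_add_mul_mem_Icc hl (hu.mem_Icc ξ))) (norm_nonneg _)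
  · have h1 : (1 : ℝ) ∈ Icc (-(3 / 2) : ℝ) (3 / 2) := by norm_num
    have h0 : (0 : ℝ) ∈ Icc (-(3 / 2) : ℝ) (3 / 2) := by norm_num
    unfold rpowInt
    rw [← integral_sub (integrable_rpowInt hu hg m h1) (integrable_rpowInt hu hg m h0),
      ← integral_const_mul, ← Real.norm_eq_abs]
    refine norm_integral_le_of_norm_le (hg.abs.const_mul (C * ε)) (Eventually.of_forall fun ξ => ?_)
    rw [← sub_mul, norm_mul]
    refine mul_le_mul_of_nonneg_right ?_ (norm_nonneg _)
    refine (hC' _ (one_add_mul_mem_Icc h1 (hu.mem_Icc ξ)) _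
      (one_add_mul_mem_Icc h0 (hu.mem_Icc ξ))).trans ?_
    have : 1 + 1 * u ξ - (1 + 0 * u ξ) = u ξ := by ring
    rw [this]
    exact mul_le_mul_of_nonneg_left (hu.abs_le ξ) hC0

end rpowInt

/-- The density of the Gagliardo seminorm. -/
def gagDens {n : ℕ} (γ : ℝ) (u : USphere n → ℝ) (z : USphere n × USphere n) : ℝ :=
  (u z.1 - u z.2) ^ 2 / ‖(z.1 : Eucl n) - (z.2 : Eucl n)‖ ^ γ

/-- The parameters of `smoothKer` at two points of the sphere and two points of `[0, 1]`. -/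
def kerPar {n : ℕ} (u : USphere n → ℝ) (w : (USphere n × USphere n) × ℝ × ℝ) : ℝ × ℝ × ℝ :=
  (u w.1.2 + (u w.1.1 - u w.1.2) * w.2.1, u w.1.2 + (u w.1.1 - u w.1.2) * w.2.2,
    (w.2.1 - w.2.2) * ((u w.1.1 - u w.1.2) / ‖(w.1.1 : Eucl n) - (w.1.2 : Eucl n)‖))

/-- Lebesgue measure on the unit square. -/
def unitSq : Measure (ℝ × ℝ) :=
  (volume.restrict (Icc (0 : ℝ) 1)).prod (volume.restrict (Icc (0 : ℝ) 1))

instance : IsProbabilityMeasure unitSq := by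
  have : IsProbabilityMeasure (volume.restrict (Icc (0 : ℝ) 1)) := ⟨by simp⟩
  unfold unitSq
  infer_instance

/-- The measure on pairs of points of the sphere and points of the unit square. -/
def crossMeas (n : ℕ) : Measure ((USphere n × USphere n) × ℝ × ℝ) :=
  ((surf n).prod (surf n)).prod unitSq

/-- The integral of `F (l, ·)` against the Gagliardo density. -/
def kerInt {n : ℕ} (γ : ℝ) (F : ℝ × ℝ × ℝ × ℝ → ℝ) (u : USphere n → ℝ) (l : ℝ) : ℝ :=
  ∫ w, F (l, kerPar u w) * gagDens γ u w.1 ∂(crossMeas n)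

lemma ae_unitSq : ∀ᵐ q ∂unitSq, q ∈ Icc (0 : ℝ) 1 ×ˢ Icc (0 : ℝ) 1 := by
  rw [unitSq, Measure.prod_restrict]
  exact ae_restrict_mem (measurableSet_Icc.prod measurableSet_Icc)

section kerInt

variable {n : ℕ} {u : USphere n → ℝ} {ε : ℝ}

lemma gagDens_nonneg (γ : ℝ) (z : USphere n × USphere n) : 0 ≤ gagDens γ u z := by
  unfold gagDens; positivity

lemma measurable_gagDens (γ : ℝ) (hu : Measurable u) : Measurable (gagDens γ u) := by
  unfold gagDens; fun_prop

lemma measurable_kerPar (hu : Measurable u) : Measurable (kerPar u) := by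
  unfold kerPar; fun_prop

lemma abs_add_sub_mul_le {a b p : ℝ} {ε : ℝ} (ha : |a| ≤ ε) (hb : |b| ≤ ε)
    (hp : p ∈ Icc (0 : ℝ) 1) : |b + (a - b) * p| ≤ ε := by
  have h := (convex_Icc (-ε) ε) (abs_le.1 hb) (abs_le.1 ha) (sub_nonneg.2 hp.2) hp.1 (by ring)
  rw [show (1 - p) • b + p • a = b + (a - b) * p by simp only [smul_eq_mul]; ring] at h
  exact abs_le.2 h

/-- The first two parameters are convex combinations of values of `u`; the third is a difference
quotient, bounded by `2 ε ≤ 1` (and zero by convention where the points coincide). -/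
lemma LipBound.kerPar_bounds (hu : LipBound u ε) {w : (USphere n × USphere n) × ℝ × ℝ}
    (hw : w.2 ∈ Icc (0 : ℝ) 1 ×ˢ Icc (0 : ℝ) 1) : kerPar u w ∈ parBox ∧ ‖kerPar u w‖ ≤ 2 * ε := by
  have h1 := abs_add_sub_mul_le (hu.abs_le w.1.1) (hu.abs_le w.1.2) hw.1
  have h2 := abs_add_sub_mul_le (hu.abs_le w.1.1) (hu.abs_le w.1.2) hw.2
  have h3 : |(w.2.1 - w.2.2) * ((u w.1.1 - u w.1.2) / ‖(w.1.1 : Eucl n) - (w.1.2 : Eucl n)‖)| ≤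
      2 * ε := by
    rw [abs_mul, abs_div, abs_norm]
    have h4 : |w.2.1 - w.2.2| ≤ 1 := _root_.abs_le.2 ⟨by linarith [hw.1.1, hw.2.2], by
      linarith [hw.1.2, hw.2.1]⟩
    have h5 : |u w.1.1 - u w.1.2| / ‖(w.1.1 : Eucl n) - (w.1.2 : Eucl n)‖ ≤ 2 * ε :=
      div_le_of_le_mul₀ (norm_nonneg _) (by linarith [hu.nonneg]) (hu.lip _ _)
    calc _ ≤ 1 * (2 * ε) := mul_le_mul h4 h5 (by positivity) zero_le_one
      _ = _ := one_mul _
  have hh := hu.le_half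
  have h0 := hu.nonneg
  refine ⟨⟨_root_.abs_le.1 (h1.trans hh), _root_.abs_le.1 (h2.trans hh),
    _root_.abs_le.1 (h3.trans (by linarith))⟩, ?_⟩
  rw [Prod.norm_def, Prod.norm_def]
  exact max_le (h1.trans (by linarith)) (max_le (h2.trans (by linarith)) h3)

lemma LipBound.ae_kerPar (hu : LipBound u ε) :
    ∀ᵐ w ∂(crossMeas n), kerPar u w ∈ parBox ∧ ‖kerPar u w‖ ≤ 2 * ε := by
  have : ∀ᵐ w ∂(crossMeas n), w.2 ∈ Icc (0 : ℝ) 1 ×ˢ Icc (0 : ℝ) 1 :=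
    Measure.quasiMeasurePreserving_snd.ae ae_unitSq
  filter_upwards [this] with w hw using hu.kerPar_bounds hw

lemma LipBound.gagDens_le (hu : LipBound u ε) (γ : ℝ) (z : USphere n × USphere n) :
    gagDens γ u z ≤ (2 * ε) ^ 2 * (‖(z.1 : Eucl n) - (z.2 : Eucl n)‖ ^ 2 /
      ‖(z.1 : Eucl n) - (z.2 : Eucl n)‖ ^ γ) := by
  unfold gagDens
  rw [← mul_div_assoc, ← mul_pow, ← sq_abs (u z.1 - u z.2)]
  gcongr
  exact hu.lip _ _

lemma LipBound.integrable_gagDens (hn : 1 ≤ n) (hu : LipBound u ε) {α : ℝ} (hα : 0 < α)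
    (hα1 : α < 1) : Integrable (gagDens (n + α) u) ((surf n).prod (surf n)) := by
  refine ((integrable_sq_div_rpow hn hα hα1).const_mul ((2 * ε) ^ 2)).mono'
    (measurable_gagDens _ hu.cont.measurable).aestronglyMeasurable (Eventually.of_forall fun z => ?_)
  rw [Real.norm_of_nonneg (gagDens_nonneg _ _)]
  exact hu.gagDens_le _ z

variable {γ : ℝ}

lemma integrable_gagDens_fst (hi : Integrable (gagDens γ u) ((surf n).prod (surf n))) :
    Integrable (fun w => gagDens γ u w.1) (crossMeas n) :=
  hi.comp_fst unitSq

lemma integral_gagDens_fst : ∫ w, gagDens γ u w.1 ∂(crossMeas n) =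
    ∫ z, gagDens γ u z ∂((surf n).prod (surf n)) := by
  rw [crossMeas, integral_fun_fst]
  simp

variable {F F' : ℝ × ℝ × ℝ × ℝ → ℝ} {C : ℝ}

lemma integrable_kerInt (hu : LipBound u ε)
    (hi : Integrable (gagDens γ u) ((surf n).prod (surf n))) (hF : Measurable F)
    {l : ℝ} (hC : ∀ z ∈ parBox, |F (l, z)| ≤ C) :
    Integrable (fun w => F (l, kerPar u w) * gagDens γ u w.1) (crossMeas n) := by
  refine (integrable_gagDens_fst hi).bdd_mul (c := C)
    (hF.comp (measurable_const.prodMk (measurable_kerPar hu.cont.measurable))).aestronglyMeasurable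
    ?_
  filter_upwards [hu.ae_kerPar] with w hw using hC _ hw.1

lemma abs_kerInt_le (hu : LipBound u ε)
    (hi : Integrable (gagDens γ u) ((surf n).prod (surf n)))
    {l : ℝ} (hC : ∀ z ∈ parBox, |F (l, z)| ≤ C) :
    |kerInt γ F u l| ≤ C * ∫ z, gagDens γ u z ∂((surf n).prod (surf n)) := by
  rw [← integral_gagDens_fst, ← integral_const_mul, ← Real.norm_eq_abs]
  refine norm_integral_le_of_norm_le ((integrable_gagDens_fst hi).const_mul C) ?_
  filter_upwards [hu.ae_kerPar] with w hw
  rw [norm_mul, Real.norm_of_nonneg (gagDens_nonneg _ _)]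
  exact mul_le_mul_of_nonneg_right (hC _ hw.1) (gagDens_nonneg _ _)

/-- A bound linear in `‖z‖` becomes the factor `2 ε`, since all parameters have norm at most `2 ε`.
-/
lemma abs_kerInt_sub_le (hu : LipBound u ε)
    (hi : Integrable (gagDens γ u) ((surf n).prod (surf n))) (hF : Measurable F) {C' : ℝ}
    (hC0 : 0 ≤ C) (hC'1 : ∀ z ∈ parBox, |F (1, z)| ≤ C') (hC'0 : ∀ z ∈ parBox, |F (0, z)| ≤ C')
    (hC : ∀ z ∈ parBox, |F (1, z) - F (0, z)| ≤ C * ‖z‖) :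
    |kerInt γ F u 1 - kerInt γ F u 0| ≤
      C * (2 * ε) * ∫ z, gagDens γ u z ∂((surf n).prod (surf n)) := by
  unfold kerInt
  rw [← integral_sub (integrable_kerInt hu hi hF hC'1) (integrable_kerInt hu hi hF hC'0),
    ← integral_gagDens_fst, ← integral_const_mul, ← Real.norm_eq_abs]
  refine norm_integral_le_of_norm_le ((integrable_gagDens_fst hi).const_mul _) ?_
  filter_upwards [hu.ae_kerPar] with w hw
  rw [← sub_mul, norm_mul, Real.norm_of_nonneg (gagDens_nonneg _ _)]
  exact mul_le_mul_of_nonneg_right ((hC _ hw.1).trans (mul_le_mul_of_nonneg_left hw.2 hC0))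
    (gagDens_nonneg _ _)

lemma hasDerivAt_kerInt (hu : LipBound u ε)
    (hi : Integrable (gagDens γ u) ((surf n).prod (surf n))) (hF : Measurable F)
    (hF' : Measurable F')
    (hC : ∀ l ∈ Ioo (-(3 / 2) : ℝ) (3 / 2), ∀ z ∈ parBox, |F (l, z)| ≤ C ∧ |F' (l, z)| ≤ C)
    (hd : ∀ l ∈ Ioo (-(3 / 2) : ℝ) (3 / 2), ∀ z ∈ parBox,
      HasDerivAt (fun l => F (l, z)) (F' (l, z)) l) {l : ℝ}
    (hl : l ∈ Ioo (-(3 / 2) : ℝ) (3 / 2)) :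
    HasDerivAt (kerInt γ F u) (kerInt γ F' u l) l := by
  refine (hasDerivAt_integral_of_dominated_loc_of_deriv_le (μ := crossMeas n)
    (s := Ioo (-(3 / 2) : ℝ) (3 / 2)) (bound := fun w => C * gagDens γ u w.1)
    (F := fun l w => F (l, kerPar u w) * gagDens γ u w.1)
    (F' := fun l w => F' (l, kerPar u w) * gagDens γ u w.1)
    (isOpen_Ioo.mem_nhds hl) ?_ ?_ ?_ ?_ ?_ ?_).2
  · filter_upwards [isOpen_Ioo.mem_nhds hl] with l' hl'
    exact (integrable_kerInt hu hi hF fun z hz => (hC l' hl' z hz).1).aestronglyMeasurable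
  · exact integrable_kerInt hu hi hF fun z hz => (hC l hl z hz).1
  · exact (integrable_kerInt hu hi hF' fun z hz => (hC l hl z hz).2).aestronglyMeasurable
  · filter_upwards [hu.ae_kerPar] with w hw l' hl'
    rw [norm_mul, Real.norm_of_nonneg (gagDens_nonneg _ _)]
    exact mul_le_mul_of_nonneg_right (hC l' hl' _ hw.1).2 (gagDens_nonneg _ _)
  · exact (integrable_gagDens_fst hi).const_mul C
  · filter_upwards [hu.ae_kerPar] with w hw l' hl'
    exact (hd l' hl' _ hw.1).mul_const _

end kerInt

/-! ### The perimeter as a twice differentiable function of `l`. -/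

section perimeter

variable {n : ℕ} {u : USphere n → ℝ} {ε α : ℝ}

lemma integrable_toReal_ballDens (hn : 1 ≤ n) (hα : 0 < α) (hα1 : α < 1) :
    Integrable (fun ξ : USphere n => (ballDens n α ξ).toReal) (surf n) := by
  obtain ⟨C, hC⟩ := exists_ballDens_le (n := n) hn hα hα1
  refine (integrable_const (max C 0)).mono'
    (measurable_ballDens n α).ennreal_toReal.aestronglyMeasurable (Eventually.of_forall fun ξ => ?_)
  rw [Real.norm_of_nonneg ENNReal.toReal_nonneg]
  have := ENNReal.toReal_mono ENNReal.ofReal_ne_top (hC ξ)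
  rwa [ENNReal.toReal_ofReal'] at this

lemma ballDens_ne_top (hn : 1 ≤ n) (hα : 0 < α) (hα1 : α < 1) (ξ : USphere n) :
    ballDens n α ξ ≠ ⊤ := by
  obtain ⟨C, hC⟩ := exists_ballDens_le (n := n) hn hα hα1
  exact ne_top_of_le_ne_top ENNReal.ofReal_ne_top (hC ξ)

lemma smoothKer_nonneg {l : ℝ} (hl : l ∈ Icc (-(3 / 2) : ℝ) (3 / 2)) (γ : ℝ) {z : ℝ × ℝ × ℝ}
    (hz : z ∈ parBox) : 0 ≤ smoothKer n γ (l, z) := by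
  have h1 := one_add_mul_pos_of_abs_le hl hz.1
  have h2 := one_add_mul_pos_of_abs_le hl hz.2.1
  have h3 : 0 ≤ (1 + l * z.1) * (1 + l * z.2.1) := mul_nonneg (by linarith) (by linarith)
  unfold smoothKer
  simp only
  positivity

/-- The perimeter of the graph sets `E_{l u}` as a function of `l`. -/
def perimFun (n : ℕ) (α : ℝ) (u : USphere n → ℝ) (l : ℝ) : ℝ :=
  rpowInt (n - α) (fun ξ => (ballDens n α ξ).toReal) u l +
    1 / 2 * kerInt (n + α) (smoothKer n (n + α)) u l

lemma kerInt_smoothKer_nonneg (hu : LipBound u ε) (γ : ℝ) {l : ℝ}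
    (hl : l ∈ Icc (-(3 / 2) : ℝ) (3 / 2)) : 0 ≤ kerInt γ (smoothKer n γ) u l := by
  refine integral_nonneg_of_ae ?_
  filter_upwards [hu.ae_kerPar] with w hw
  exact mul_nonneg (smoothKer_nonneg hl _ hw.1) (gagDens_nonneg _ _)

/-- Both terms of the symmetrized formula are integrals of nonnegative integrable functions, so they
pass to real integrals. This gives finiteness of the perimeter at the same time. -/
lemma fracPerimeter_graphSet_smul (hn : 1 ≤ n) (hα : 0 < α) (hα1 : α < 1) (hu : LipBound u ε)
    {l : ℝ} (hl : l ∈ Icc (-(3 / 2) : ℝ) (3 / 2)) :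
    fracPerimeter α (graphSet (l • u)) = ENNReal.ofReal (perimFun n α u l) := by
  have hum := hu.cont.measurable
  have hpos : ∀ x, 0 < 1 + (l • u) x := fun x => by
    have := one_add_mul_pos_of_abs_le hl (hu.mem_Icc x)
    simp only [Pi.smul_apply, smul_eq_mul]
    linarith
  have h2 := two_mul_fracPerimeter_graphSet hn α (hu.cont.const_smul l) hpos
  have hA : ∫⁻ ξ, ENNReal.ofReal ((1 + (l • u) ξ) ^ (n - α)) * ballDens n α ξ ∂(surf n) =
      ENNReal.ofReal (rpowInt (n - α) (fun ξ => (ballDens n α ξ).toReal) u l) := by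
    rw [rpowInt, ofReal_integral_eq_lintegral_ofReal
      (integrable_rpowInt hu (integrable_toReal_ballDens hn hα hα1) _ hl)]
    · refine lintegral_congr fun ξ => ?_
      have h0 : 0 ≤ (1 + l * u ξ) ^ ((n : ℝ) - α) := Real.rpow_nonneg (hpos ξ).le _
      rw [ENNReal.ofReal_mul h0,
        ENNReal.ofReal_toReal (ballDens_ne_top hn hα hα1 ξ)]
      rfl
    · exact Eventually.of_forall fun ξ =>
        mul_nonneg (Real.rpow_nonneg (hpos ξ).le _) ENNReal.toReal_nonneg
  have hmK : Measurable fun w : (USphere n × USphere n) × ℝ × ℝ => ENNReal.ofReal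
      (smoothKer n (n + α) (l, kerPar u w) * gagDens (n + α) u w.1) :=
    ENNReal.measurable_ofReal.comp (((measurable_smoothKer n _).comp
      (measurable_const.prodMk (measurable_kerPar hum))).mul
      ((measurable_gagDens _ hum).comp measurable_fst))
  obtain ⟨C, -, hC, -⟩ := exists_bound_smoothKer n (n + α)
  have hB : ∫⁻ ξ, ∫⁻ η, (∫⁻ p in Icc (0 : ℝ) 1, ∫⁻ q in Icc (0 : ℝ) 1, ENNReal.ofReal
        (((l • u) ξ - (l • u) η) ^ 2 * radKer n (n + α) ‖(ξ : Eucl n) - (η : Eucl n)‖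
          (1 + (l • u) η + ((l • u) ξ - (l • u) η) * p)
          (1 + (l • u) η + ((l • u) ξ - (l • u) η) * q))) ∂(surf n) ∂(surf n) =
      ENNReal.ofReal (kerInt (n + α) (smoothKer n (n + α)) u l) := by
    rw [kerInt, ofReal_integral_eq_lintegral_ofReal
      (integrable_kerInt hu (hu.integrable_gagDens hn hα hα1) (measurable_smoothKer n _)
        fun z hz => (hC l hl z hz).1), crossMeas, lintegral_prod _ hmK.aemeasurable,
      lintegral_prod _ hmK.lintegral_prod_right'.aemeasurable]
    · refine lintegral_congr fun ξ => lintegral_congr fun η => ?_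
      have hm' : Measurable fun q : ℝ × ℝ => ENNReal.ofReal
          (smoothKer n (n + α) (l, kerPar u ((ξ, η), q)) * gagDens (n + α) u (ξ, η)) :=
        hmK.comp (measurable_const.prodMk measurable_id)
      rw [unitSq, lintegral_prod _ hm'.aemeasurable]
      refine setLIntegral_congr_fun measurableSet_Icc fun p hp =>
        setLIntegral_congr_fun measurableSet_Icc fun q hq => ?_
      have hb := (hu.kerPar_bounds (w := ((ξ, η), (p, q))) ⟨hp, hq⟩).1
      have h3 := one_add_mul_pos_of_abs_le hl hb.1
      have h4 := one_add_mul_pos_of_abs_le hl hb.2.1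
      simp only [Pi.smul_apply, smul_eq_mul]
      rw [sq_mul_radKer_eq n (norm_nonneg _) (fun h => ?_) (lt_of_lt_of_le (by norm_num) h3)
        (lt_of_lt_of_le (by norm_num) h4), mul_comm]
      · rfl
      · rw [norm_eq_zero, sub_eq_zero] at h
        rw [Subtype.ext h]
    · filter_upwards [hu.ae_kerPar] with w hw
      exact mul_nonneg (smoothKer_nonneg hl _ hw.1) (gagDens_nonneg _ _)
  have hk := kerInt_smoothKer_nonneg hu (n + α) hl
  have hr : 0 ≤ rpowInt (n - α) (fun ξ => (ballDens n α ξ).toReal) u l :=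
    integral_nonneg fun ξ => mul_nonneg (Real.rpow_nonneg (hpos ξ).le _) ENNReal.toReal_nonneg
  rw [hA, hB] at h2
  refine (ENNReal.mul_right_inj two_ne_zero ENNReal.ofNat_ne_top).1 (h2.trans ?_)
  have two : (2 : ℝ≥0∞) = ENNReal.ofReal 2 := by simp
  rw [two, ← ENNReal.ofReal_mul zero_le_two, ← ENNReal.ofReal_mul zero_le_two,
    ← ENNReal.ofReal_add (by positivity) hk, perimFun]
  congr 1
  ring

/-- The kernel term is nonnegative and is dropped; in the other, `1 + l u ≥ 1/4` leaves a fixed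
multiple of the integral of the positive density of the ball. -/
lemma exists_pos_le_perimFun (hn : 1 ≤ n) (hα : 0 < α) (hα1 : α < 1) :
    ∃ c : ℝ, 0 < c ∧ ∀ (u : USphere n → ℝ) (ε : ℝ), LipBound u ε →
      ∀ l ∈ Icc (-(3 / 2) : ℝ) (3 / 2), c ≤ perimFun n α u l := by
  have hi := integrable_toReal_ballDens (n := n) hn hα hα1
  have hpos : 0 < ∫ ξ : USphere n, (ballDens n α ξ).toReal ∂(surf n) := by
    rw [integral_pos_iff_support_of_nonneg (fun _ => ENNReal.toReal_nonneg) hi]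
    have : Function.support (fun ξ : USphere n => (ballDens n α ξ).toReal) = univ :=
      eq_univ_of_forall fun ξ => (ENNReal.toReal_pos (ballDens_pos hn α ξ).ne'
        (ballDens_ne_top hn hα hα1 ξ)).ne'
    rw [this]
    exact pos_iff_ne_zero.2 (surf_univ_ne_zero hn)
  refine ⟨(1 / 4) ^ (n - α) * ∫ ξ : USphere n, (ballDens n α ξ).toReal ∂(surf n), by positivity,
    fun u ε hu l hl => ?_⟩
  have hk := kerInt_smoothKer_nonneg hu (n + α) hl
  have h1 : (1 / 4) ^ (n - α) * ∫ ξ : USphere n, (ballDens n α ξ).toReal ∂(surf n) ≤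
      rpowInt (n - α) (fun ξ => (ballDens n α ξ).toReal) u l := by
    rw [← integral_const_mul]
    refine integral_mono (hi.const_mul _) (integrable_rpowInt hu hi _ hl) fun ξ => ?_
    have hn' : (1 : ℝ) ≤ n := by exact_mod_cast hn
    exact mul_le_mul_of_nonneg_right (Real.rpow_le_rpow (by norm_num)
      (one_add_mul_mem_Icc hl (hu.mem_Icc ξ)).1 (by linarith)) ENNReal.toReal_nonneg
  rw [perimFun]
  linarith

/-- Existence of two derivatives of the perimeter along `l ↦ E_{l u}`, and their bounds. -/
lemma exists_bound_perimFun (hn : 1 ≤ n) (hα : 0 < α) (hα1 : α < 1) :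
    ∃ K : ℝ, 0 ≤ K ∧ ∀ (u : USphere n → ℝ) (ε : ℝ), LipBound u ε →
      ∃ p1 p2 : ℝ → ℝ, perimFun n α u 0 ≤ K ∧
        (∀ l ∈ Ioo (-(3 / 2) : ℝ) (3 / 2), HasDerivAt (perimFun n α u) (p1 l) l ∧
          HasDerivAt p1 (p2 l) l ∧
          |p1 l| ≤ K * ((∫ ξ, |u ξ| ∂(surf n)) +
            ∫ z, gagDens (n + α) u z ∂((surf n).prod (surf n))) ∧
          |p2 l| ≤ K * ((∫ ξ, u ξ ^ 2 ∂(surf n)) +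
            ∫ z, gagDens (n + α) u z ∂((surf n).prod (surf n)))) ∧
        |p2 1 - p2 0| ≤ K * ε * ((∫ ξ, u ξ ^ 2 ∂(surf n)) +
            ∫ z, gagDens (n + α) u z ∂((surf n).prod (surf n))) := by
  have hi := integrable_toReal_ballDens (n := n) hn hα hα1
  obtain ⟨D, hD⟩ := exists_ballDens_le (n := n) hn hα hα1
  have hD' : ∀ ξ : USphere n, (ballDens n α ξ).toReal ≤ max D 0 := fun ξ => by
    have := ENNReal.toReal_mono ENNReal.ofReal_ne_top (hD ξ)
    rwa [ENNReal.toReal_ofReal'] at this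
  set E := max D 0
  have hE0 : 0 ≤ E := le_max_right _ _
  set m : ℝ := n - α
  obtain ⟨C1, hC10, hC1⟩ := exists_bound_rpowInt n (m - 1)
  obtain ⟨C2, hC20, hC2⟩ := exists_bound_rpowInt n (m - 1 - 1)
  obtain ⟨CM, hCM0, hCM, hCM'⟩ := exists_bound_smoothKer n (n + α)
  set G := ∫ ξ : USphere n, (ballDens n α ξ).toReal ∂(surf n) with hG
  have hG0 : 0 ≤ G := integral_nonneg fun _ => ENNReal.toReal_nonneg
  -- One and two differentiations of `(1 + l u)^m` produce the densities `m u c` and `(m - 1) m u²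
  -- c`, with `c ≤ E` the density of the ball. The constants `a1`, `a2` bound these contributions.
  set a1 := C1 * (|m| * E)
  set a2 := C2 * (|m - 1| * |m| * E)
  have ha1 : 0 ≤ a1 := by positivity
  have ha2 : 0 ≤ a2 := by positivity
  refine ⟨a1 + a2 + CM + G, by positivity, fun u ε hu => ?_⟩
  set c : USphere n → ℝ := fun ξ => (ballDens n α ξ).toReal with hc
  have hc0 : ∀ ξ, 0 ≤ c ξ := fun _ => ENNReal.toReal_nonneg
  have hg1 := hu.integrable_mul hi m
  have hg2 := hu.integrable_mul hg1 (m - 1)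
  have hum := hu.cont.measurable
  have hiu : Integrable (fun ξ => |u ξ|) (surf n) :=
    (integrable_const ε).mono' (Measurable.aestronglyMeasurable (by fun_prop))
      (Eventually.of_forall fun ξ => by simpa using hu.abs_le ξ)
  have hiu2 : Integrable (fun ξ => u ξ ^ 2) (surf n) :=
    (integrable_const (ε ^ 2)).mono' (Measurable.aestronglyMeasurable (by fun_prop))
      (Eventually.of_forall fun ξ => by
        rw [Real.norm_eq_abs, abs_pow]
        exact pow_le_pow_left₀ (abs_nonneg _) (hu.abs_le ξ) 2)
  have hI1 : ∫ ξ, |m * u ξ * c ξ| ∂(surf n) ≤ |m| * E * ∫ ξ, |u ξ| ∂(surf n) := by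
    rw [← integral_const_mul]
    refine integral_mono hg1.abs (hiu.const_mul _) fun ξ => ?_
    simp only [abs_mul, abs_of_nonneg (hc0 ξ)]
    calc |m| * |u ξ| * c ξ ≤ |m| * |u ξ| * E := by gcongr; exact hD' ξ
      _ = _ := by ring
  have hI2 : ∫ ξ, |(m - 1) * u ξ * (m * u ξ * c ξ)| ∂(surf n) ≤
      |m - 1| * |m| * E * ∫ ξ, u ξ ^ 2 ∂(surf n) := by
    rw [← integral_const_mul]
    refine integral_mono hg2.abs (hiu2.const_mul _) fun ξ => ?_
    simp only [abs_mul, abs_of_nonneg (hc0 ξ)]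
    rw [← sq_abs (u ξ)]
    calc |m - 1| * |u ξ| * (|m| * |u ξ| * c ξ) ≤ |m - 1| * |u ξ| * (|m| * |u ξ| * E) := by
          gcongr; exact hD' ξ
      _ = _ := by ring
  have hX := hu.integrable_gagDens hn hα hα1
  set X := ∫ z, gagDens (n + α) u z ∂((surf n).prod (surf n))
  have hX0 : 0 ≤ X := integral_nonneg fun z => gagDens_nonneg _ z
  have hU1 : 0 ≤ ∫ ξ, |u ξ| ∂(surf n) := integral_nonneg fun _ => abs_nonneg _
  have hU2 : 0 ≤ ∫ ξ, u ξ ^ 2 ∂(surf n) := integral_nonneg fun _ => sq_nonneg _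
  set U1 := ∫ ξ, |u ξ| ∂(surf n)
  set U2 := ∫ ξ, u ξ ^ 2 ∂(surf n)
  have hM0 := measurable_smoothKer n (n + α)
  have hM1 := measurable_pderiv (smoothKer n (n + α))
  have hM2 := measurable_pderiv (pderiv (smoothKer n (n + α)))
  have hone : (1 : ℝ) ∈ Icc (-(3 / 2) : ℝ) (3 / 2) := by norm_num
  have hzero : (0 : ℝ) ∈ Icc (-(3 / 2) : ℝ) (3 / 2) := by norm_num
  refine ⟨fun l => rpowInt (m - 1) (fun ξ => m * u ξ * c ξ) u l +
      1 / 2 * kerInt (n + α) (pderiv (smoothKer n (n + α))) u l,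
    fun l => rpowInt (m - 1 - 1) (fun ξ => (m - 1) * u ξ * (m * u ξ * c ξ)) u l +
      1 / 2 * kerInt (n + α) (pderiv (pderiv (smoothKer n (n + α)))) u l, ?_, ?_, ?_⟩
  · have h1 : perimFun n α u 0 = G := by
      simp [perimFun, rpowInt, kerInt, smoothKer, hG, hc]
    rw [h1]
    linarith
  · intro l hl
    have hl' := Ioo_subset_Icc_self hl
    refine ⟨?_, ?_, ?_, ?_⟩
    · exact (hasDerivAt_rpowInt hu hi m hl).add ((hasDerivAt_kerInt hu hX hM0 hM1
        (fun l hl z hz => ⟨(hCM l (Ioo_subset_Icc_self hl) z hz).1,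
          (hCM l (Ioo_subset_Icc_self hl) z hz).2.1⟩)
        (fun l hl z hz => (hasDerivAt_smoothKer n _ hl hz).1) hl).const_mul _)
    · exact (hasDerivAt_rpowInt hu hg1 (m - 1) hl).add ((hasDerivAt_kerInt hu hX hM1 hM2
        (fun l hl z hz => (hCM l (Ioo_subset_Icc_self hl) z hz).2)
        (fun l hl z hz => (hasDerivAt_smoothKer n _ hl hz).2) hl).const_mul _)
    · have h1 := (hC1 u _ ε hu hg1).1 l hl'
      have h2 := abs_kerInt_le hu hX (F := pderiv (smoothKer n (n + α)))
        fun z hz => (hCM l hl' z hz).2.1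
      have h3 := mul_le_mul_of_nonneg_left hI1 hC10
      refine (abs_add_le _ _).trans ?_
      rw [abs_mul, abs_of_pos (by norm_num : (0 : ℝ) < 1 / 2)]
      have h4 : C1 * (|m| * E * U1) = a1 * U1 := by ring
      nlinarith [mul_nonneg ha1 hX0, mul_nonneg ha2 hX0, mul_nonneg ha2 hU1, mul_nonneg hCM0 hU1,
        mul_nonneg hG0 hX0, mul_nonneg hG0 hU1, mul_nonneg hCM0 hX0]
    · have h1 := (hC2 u _ ε hu hg2).1 l hl'
      have h2 := abs_kerInt_le hu hX (F := pderiv (pderiv (smoothKer n (n + α))))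
        fun z hz => (hCM l hl' z hz).2.2
      have h3 := mul_le_mul_of_nonneg_left hI2 hC20
      refine (abs_add_le _ _).trans ?_
      rw [abs_mul, abs_of_pos (by norm_num : (0 : ℝ) < 1 / 2)]
      have h4 : C2 * (|m - 1| * |m| * E * U2) = a2 * U2 := by ring
      nlinarith [mul_nonneg ha1 hX0, mul_nonneg ha2 hX0, mul_nonneg ha1 hU2, mul_nonneg hCM0 hU2,
        mul_nonneg hG0 hX0, mul_nonneg hG0 hU2, mul_nonneg hCM0 hX0]
  · have h1 := (hC2 u _ ε hu hg2).2
    have h2 := abs_kerInt_sub_le hu hX hM2 hCM0 (fun z hz => (hCM 1 hone z hz).2.2)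
      (fun z hz => (hCM 0 hzero z hz).2.2) hCM'
    have h3 := mul_le_mul_of_nonneg_left hI2 (mul_nonneg hC20 hu.nonneg)
    have hε := hu.nonneg
    have h4 : C2 * ε * (|m - 1| * |m| * E * U2) = a2 * (ε * U2) := by ring
    have hsplit : ∀ a b c d : ℝ, a + 1 / 2 * b - (c + 1 / 2 * d) = (a - c) + 1 / 2 * (b - d) :=
      fun a b c d => by ring
    rw [hsplit]
    refine (abs_add_le _ _).trans ?_
    rw [abs_mul, abs_of_pos (by norm_num : (0 : ℝ) < 1 / 2)]
    have hεX := mul_nonneg hε hX0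
    have hεU := mul_nonneg hε hU2
    nlinarith [mul_nonneg ha1 hεX, mul_nonneg ha2 hεX, mul_nonneg ha1 hεU, mul_nonneg hCM0 hεU,
        mul_nonneg hG0 hεX, mul_nonneg hG0 hεU, mul_nonneg hCM0 hεX]

end perimeter

/-! ### From the C¹ norm to a Lipschitz bound for the chordal distance. -/

section regularity

variable {n : ℕ} {u : USphere n → ℝ}

lemma homExt_coe (u : USphere n → ℝ) (x : USphere n) : homExt u x = u x := by
  have hx : (x : Eucl n) ≠ 0 := fun h => by simpa [h] using norm_sphere x
  rw [homExt, dif_pos hx]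
  congr 1
  exact Subtype.ext (by simp [radialProj])

lemma homExt_smul (u : USphere n → ℝ) {c : ℝ} (hc : 0 < c) (x : Eucl n) :
    homExt u (c • x) = homExt u x := by
  unfold homExt
  rcases eq_or_ne x 0 with rfl | hx
  · simp
  · rw [dif_pos hx, dif_pos (smul_ne_zero hc.ne' hx)]
    congr 1
    refine Subtype.ext ?_
    simp only [radialProj, norm_smul, Real.norm_of_nonneg hc.le, smul_smul]
    congr 1
    field_simp

lemma isOpen_compl_zero : IsOpen ({0}ᶜ : Set (Eucl n)) := isOpen_compl_singleton

lemma coe_sphere_mem_compl_zero (x : USphere n) : (x : Eucl n) ∈ ({0}ᶜ : Set (Eucl n)) :=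
  fun h => by simpa [show (x : Eucl n) = 0 from h] using norm_sphere x

lemma IsC1.continuous (hu : IsC1 u) : Continuous u := by
  have h := hu.continuousOn.comp_continuous continuous_subtype_val coe_sphere_mem_compl_zero
  exact h.congr (homExt_coe u)

lemma IsC1.continuous_tangGradNorm (hu : IsC1 u) : Continuous (tangGradNorm u) :=
  ((hu.continuousOn_fderiv_of_isOpen isOpen_compl_zero le_rfl).comp_continuous
    continuous_subtype_val coe_sphere_mem_compl_zero).norm

lemma IsC1.abs_le_c1Norm (hu : IsC1 u) (x : USphere n) : |u x| ≤ c1Norm u :=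
  (le_ciSup (isCompact_range hu.continuous.abs).bddAbove x).trans (le_max_left _ _)

lemma IsC1.tangGradNorm_le_c1Norm (hu : IsC1 u) (x : USphere n) : tangGradNorm u x ≤ c1Norm u :=
  (le_ciSup (isCompact_range hu.continuous_tangGradNorm).bddAbove x).trans (le_max_right _ _)

/-- The extension is homogeneous of degree zero, so its differential is homogeneous of degree `-1`
and is controlled by its values on the sphere. -/
lemma IsC1.norm_fderiv_homExt_le (hu : IsC1 u) {z : Eucl n} (hz : z ≠ 0) :
    ‖fderiv ℝ (homExt u) z‖ ≤ ‖z‖⁻¹ * c1Norm u := by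
  have hz' : 0 < ‖z‖⁻¹ := inv_pos.2 (norm_pos_iff.2 hz)
  have h1 : homExt u = fun x => homExt u (‖z‖⁻¹ • x) := by
    ext x; rw [homExt_smul u hz']
  have h2 : fderiv ℝ (homExt u) z = ‖z‖⁻¹ • fderiv ℝ (homExt u) (‖z‖⁻¹ • z) := by
    conv_lhs => rw [h1]
    exact fderiv_comp_smul ..
  rw [h2, norm_smul, Real.norm_of_nonneg hz'.le]
  exact mul_le_mul_of_nonneg_left (hu.tangGradNorm_le_c1Norm (radialProj z hz)) hz'.le

lemma c1Norm_nonneg (u : USphere n → ℝ) : 0 ≤ c1Norm u :=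
  le_max_of_le_left (Real.iSup_nonneg fun _ => abs_nonneg _)

/-- For points at distance at most `1` the chord stays outside the ball of radius `1/2`, where the
differential of the extension is at most twice the C¹ norm. For distant points the bound on `|u|`
suffices. -/
lemma IsC1.abs_sub_le (hu : IsC1 u) (x y : USphere n) :
    |u x - u y| ≤ 2 * c1Norm u * ‖(x : Eucl n) - (y : Eucl n)‖ := by
  have h0 := c1Norm_nonneg u
  rcases le_total ‖(x : Eucl n) - (y : Eucl n)‖ 1 with h | h
  · have hseg : ∀ z ∈ segment ℝ (y : Eucl n) (x : Eucl n), 1 / 2 ≤ ‖z‖ := by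
      rintro z ⟨a, b, ha, hb, hab, rfl⟩
      have e1 : a • (y : Eucl n) + b • (x : Eucl n) =
          (y : Eucl n) - (-b) • ((x : Eucl n) - (y : Eucl n)) := by
        rw [← eq_sub_iff_add_eq] at hab; rw [hab]; module
      have e2 : a • (y : Eucl n) + b • (x : Eucl n) =
          (x : Eucl n) - a • ((x : Eucl n) - (y : Eucl n)) := by
        rw [← eq_sub_iff_add_eq'] at hab; rw [hab]; module
      have h1 := norm_sub_norm_le (y : Eucl n) ((-b) • ((x : Eucl n) - (y : Eucl n)))
      have h2 := norm_sub_norm_le (x : Eucl n) (a • ((x : Eucl n) - (y : Eucl n)))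
      rw [← e1, norm_sphere, norm_smul, norm_neg, Real.norm_of_nonneg hb] at h1
      rw [← e2, norm_sphere, norm_smul, Real.norm_of_nonneg ha] at h2
      nlinarith
    have hne : ∀ z ∈ segment ℝ (y : Eucl n) (x : Eucl n), z ≠ 0 := fun z hz h => by
      have := hseg z hz
      rw [h, norm_zero] at this
      linarith
    have h1 := (convex_segment (y : Eucl n) (x : Eucl n)).norm_image_sub_le_of_norm_fderiv_le
      (𝕜 := ℝ) (f := homExt u) (C := 2 * c1Norm u)
      (fun z hz => (hu.contDiffAt (isOpen_compl_zero.mem_nhds (hne z hz))).differentiableAt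
        one_ne_zero)
      (fun z hz => (hu.norm_fderiv_homExt_le (hne z hz)).trans (mul_le_mul_of_nonneg_right
        (by
          rw [show (2 : ℝ) = (1 / 2)⁻¹ by norm_num]
          exact inv_anti₀ (by norm_num) (hseg z hz)) h0))
      (left_mem_segment ℝ _ _) (right_mem_segment ℝ _ _)
    rwa [homExt_coe, homExt_coe] at h1
  · have h1 := abs_sub (u x) (u y)
    have h2 := hu.abs_le_c1Norm x
    have h3 := hu.abs_le_c1Norm y
    nlinarith

lemma IsC1.lipBound (hu : IsC1 u) (h : c1Norm u ≤ 1 / 2) : LipBound u (c1Norm u) :=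
  ⟨hu.continuous, c1Norm_nonneg u, h, hu.abs_le_c1Norm, hu.abs_sub_le⟩

end regularity

/-! ### Stability of the derivative estimates under composition. -/

/-- Two derivatives of `f` on `(-3/2, 3/2)`, with bounds on `[0, 1]`. -/
structure Ctrl (f f1 f2 : ℝ → ℝ) (K ε h : ℝ) : Prop where
  hasDeriv : ∀ l ∈ Ioo (-(3 / 2) : ℝ) (3 / 2), HasDerivAt f (f1 l) l
  hasDeriv₁ : ∀ l ∈ Ioo (-(3 / 2) : ℝ) (3 / 2), HasDerivAt f1 (f2 l) l
  le_eps : ∀ l ∈ Icc (0 : ℝ) 1, |f1 l| ≤ K * ε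
  le_norm : ∀ l ∈ Icc (0 : ℝ) 1, |f1 l| ≤ K * h
  le_sq : ∀ l ∈ Icc (0 : ℝ) 1, |f2 l| ≤ K * h ^ 2
  sub_le : |f2 1 - f2 0| ≤ K * ε * h ^ 2

lemma Icc_zero_one_subset_Ioo : Icc (0 : ℝ) 1 ⊆ Ioo (-(3 / 2) : ℝ) (3 / 2) :=
  fun _ hx => ⟨by linarith [hx.1], by linarith [hx.2]⟩

lemma abs_sub_le_of_hasDerivAt {f f' : ℝ → ℝ} {C : ℝ}
    (hf : ∀ l ∈ Icc (0 : ℝ) 1, HasDerivAt f (f' l) l) (hC : ∀ l ∈ Icc (0 : ℝ) 1, |f' l| ≤ C)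
    {x : ℝ} (hx : x ∈ Icc (0 : ℝ) 1) : |f x - f 0| ≤ C := by
  have h0 : (0 : ℝ) ∈ Icc (0 : ℝ) 1 := by simp
  have h := (convex_Icc (0 : ℝ) 1).norm_image_sub_le_of_norm_hasDerivWithin_le
    (fun l hl => (hf l hl).hasDerivWithinAt) (fun l hl => hC l hl) h0 hx
  have hC0 : 0 ≤ C := (abs_nonneg _).trans (hC 0 h0)
  refine h.trans ?_
  rw [sub_zero, Real.norm_of_nonneg hx.1]
  exact mul_le_of_le_one_right hC0 hx.2

namespace Ctrl

variable {f f1 f2 g g1 g2 : ℝ → ℝ} {K ε h : ℝ}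

lemma abs_sub_le (hf : Ctrl f f1 f2 K ε h) {x : ℝ} (hx : x ∈ Icc (0 : ℝ) 1) :
    |f x - f 0| ≤ K * ε :=
  abs_sub_le_of_hasDerivAt (fun l hl => hf.hasDeriv l (Icc_zero_one_subset_Ioo hl)) hf.le_eps hx

lemma abs_sub_le₁ (hf : Ctrl f f1 f2 K ε h) {x : ℝ} (hx : x ∈ Icc (0 : ℝ) 1) :
    |f1 x - f1 0| ≤ K * h ^ 2 :=
  abs_sub_le_of_hasDerivAt (fun l hl => hf.hasDeriv₁ l (Icc_zero_one_subset_Ioo hl)) hf.le_sq hx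

lemma linear_sub (hf : Ctrl f f1 f2 K ε h) (hg : Ctrl g g1 g2 K ε h) {a b : ℝ} (ha : 0 ≤ a)
    (hb : 0 ≤ b) : Ctrl (fun l => a * f l - b * g l) (fun l => a * f1 l - b * g1 l)
      (fun l => a * f2 l - b * g2 l) ((a + b) * K) ε h := by
  have key : ∀ {x y B : ℝ}, |x| ≤ B → |y| ≤ B → |a * x - b * y| ≤ (a + b) * B := by
    intro x y B hx hy
    refine (abs_sub _ _).trans ?_
    rw [abs_mul, abs_mul, abs_of_nonneg ha, abs_of_nonneg hb, add_mul]
    exact add_le_add (mul_le_mul_of_nonneg_left hx ha) (mul_le_mul_of_nonneg_left hy hb)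
  refine ⟨fun l hl => ((hf.hasDeriv l hl).const_mul a).sub ((hg.hasDeriv l hl).const_mul b),
    fun l hl => ((hf.hasDeriv₁ l hl).const_mul a).sub ((hg.hasDeriv₁ l hl).const_mul b),
    fun l hl => ?_, fun l hl => ?_, fun l hl => ?_, ?_⟩
  · rw [mul_assoc]; exact key (hf.le_eps l hl) (hg.le_eps l hl)
  · rw [mul_assoc]; exact key (hf.le_norm l hl) (hg.le_norm l hl)
  · rw [mul_assoc]; exact key (hf.le_sq l hl) (hg.le_sq l hl)
  · rw [mul_assoc, mul_assoc, ← mul_assoc K]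
    convert key hf.sub_le hg.sub_le using 2
    ring

/-- Chain rule. Two bounds on the first derivative are needed: `h` twice makes `f'²` of order `h²`,
while `ε` is the gain obtained from every difference between `l = 1` and `l = 0`. -/
lemma comp (hf : Ctrl f f1 f2 K ε h) (hK : 0 ≤ K) (hε : 0 ≤ ε) {φ φ1 φ2 : ℝ → ℝ} {T : Set ℝ}
    {Q : ℝ} (hQ : 0 ≤ Q)
    (hφ : ∀ l ∈ Ioo (-(3 / 2) : ℝ) (3 / 2), HasDerivAt φ (φ1 (f l)) (f l) ∧
      HasDerivAt φ1 (φ2 (f l)) (f l))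
    (hT : ∀ l ∈ Icc (0 : ℝ) 1, f l ∈ T) (hb : ∀ x ∈ T, |φ1 x| ≤ Q ∧ |φ2 x| ≤ Q)
    (hL : ∀ x ∈ T, ∀ y ∈ T, |φ1 x - φ1 y| ≤ Q * |x - y| ∧ |φ2 x - φ2 y| ≤ Q * |x - y|) :
    Ctrl (fun l => φ (f l)) (fun l => φ1 (f l) * f1 l)
      (fun l => φ1 (f l) * f2 l + φ2 (f l) * f1 l ^ 2) (Q * (K + 3 * K ^ 2 + K ^ 3)) ε h := by
  have h01 : (1 : ℝ) ∈ Icc (0 : ℝ) 1 := by simp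
  have h00 : (0 : ℝ) ∈ Icc (0 : ℝ) 1 := by simp
  have hh : 0 ≤ K * h := (abs_nonneg _).trans (hf.le_norm 0 h00)
  have hKle : Q * K ≤ Q * (K + 3 * K ^ 2 + K ^ 3) :=
    mul_le_mul_of_nonneg_left (by nlinarith [sq_nonneg K, pow_nonneg hK 3]) hQ
  have hsq : ∀ l ∈ Icc (0 : ℝ) 1, f1 l ^ 2 ≤ K ^ 2 * h ^ 2 := fun l hl => by
    rw [← sq_abs, ← mul_pow]
    exact pow_le_pow_left₀ (abs_nonneg _) (hf.le_norm l hl) 2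
  refine ⟨fun l hl => (hφ l hl).1.comp l (hf.hasDeriv l hl), fun l hl => ?_, fun l hl => ?_,
    fun l hl => ?_, fun l hl => ?_, ?_⟩
  · have h1 := ((hφ l hl).2.comp l (hf.hasDeriv l hl)).mul (hf.hasDeriv₁ l hl)
    exact h1.congr_deriv (by simp only [Function.comp]; ring)
  · rw [abs_mul]
    calc |φ1 (f l)| * |f1 l| ≤ Q * (K * ε) :=
          mul_le_mul (hb _ (hT l hl)).1 (hf.le_eps l hl) (abs_nonneg _) hQ
      _ = Q * K * ε := by ring
      _ ≤ _ := mul_le_mul_of_nonneg_right hKle hε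
  · rw [abs_mul]
    calc |φ1 (f l)| * |f1 l| ≤ Q * (K * h) :=
          mul_le_mul (hb _ (hT l hl)).1 (hf.le_norm l hl) (abs_nonneg _) hQ
      _ ≤ Q * (K * h + (3 * K + K ^ 2) * (K * h)) :=
          mul_le_mul_of_nonneg_left (le_add_of_nonneg_right (by positivity)) hQ
      _ = _ := by ring
  · calc |φ1 (f l) * f2 l + φ2 (f l) * f1 l ^ 2| ≤ |φ1 (f l)| * |f2 l| + |φ2 (f l)| * f1 l ^ 2 := by
          refine (abs_add_le _ _).trans (le_of_eq ?_)
          rw [abs_mul, abs_mul, abs_of_nonneg (sq_nonneg (f1 l))]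
      _ ≤ Q * (K * h ^ 2) + Q * (K ^ 2 * h ^ 2) :=
          add_le_add (mul_le_mul (hb _ (hT l hl)).1 (hf.le_sq l hl) (abs_nonneg _) hQ)
            (mul_le_mul (hb _ (hT l hl)).2 (hsq l hl) (sq_nonneg _) hQ)
      _ ≤ Q * (K * h ^ 2) + Q * (K ^ 2 * h ^ 2) + Q * (2 * K ^ 2 + K ^ 3) * h ^ 2 :=
          le_add_of_nonneg_right (by positivity)
      _ = _ := by ring
  · have hfd := hf.abs_sub_le h01
    have hf1d := hf.abs_sub_le₁ h01
    -- The difference telescopes into four terms, each of order `ε h²`; in the last, `f' 1 - f' 0`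
    -- is of order `h²` and `f' 1 + f' 0` of order `ε`. Their coefficients `K²`, `K`, `K³`, `2 K²`
    -- add up to the constant of the statement.
    have e : φ1 (f 1) * f2 1 + φ2 (f 1) * f1 1 ^ 2 - (φ1 (f 0) * f2 0 + φ2 (f 0) * f1 0 ^ 2) =
        (φ1 (f 1) - φ1 (f 0)) * f2 1 + φ1 (f 0) * (f2 1 - f2 0) +
        (φ2 (f 1) - φ2 (f 0)) * f1 1 ^ 2 + φ2 (f 0) * ((f1 1 - f1 0) * (f1 1 + f1 0)) := by ring
    have t1 : |(φ1 (f 1) - φ1 (f 0)) * f2 1| ≤ Q * (K * ε) * (K * h ^ 2) := by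
      rw [abs_mul]
      exact mul_le_mul ((hL _ (hT 1 h01) _ (hT 0 h00)).1.trans (mul_le_mul_of_nonneg_left hfd hQ))
        (hf.le_sq 1 h01) (abs_nonneg _) (by positivity)
    have t2 : |φ1 (f 0) * (f2 1 - f2 0)| ≤ Q * (K * ε * h ^ 2) := by
      rw [abs_mul]
      exact mul_le_mul (hb _ (hT 0 h00)).1 hf.sub_le (abs_nonneg _) hQ
    have t3 : |(φ2 (f 1) - φ2 (f 0)) * f1 1 ^ 2| ≤ Q * (K * ε) * (K ^ 2 * h ^ 2) := by
      rw [abs_mul, abs_of_nonneg (sq_nonneg (f1 1))]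
      exact mul_le_mul ((hL _ (hT 1 h01) _ (hT 0 h00)).2.trans (mul_le_mul_of_nonneg_left hfd hQ))
        (hsq 1 h01) (sq_nonneg _) (by positivity)
    have t4 : |φ2 (f 0) * ((f1 1 - f1 0) * (f1 1 + f1 0))| ≤ Q * (K * h ^ 2 * (2 * (K * ε))) := by
      rw [abs_mul, abs_mul]
      refine mul_le_mul (hb _ (hT 0 h00)).2 (mul_le_mul hf1d ?_ (abs_nonneg _) (by positivity))
        (by positivity) hQ
      exact (abs_add_le _ _).trans (by linarith [hf.le_eps 1 h01, hf.le_eps 0 h00])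
    rw [e]
    calc _ ≤ Q * (K * ε) * (K * h ^ 2) + Q * (K * ε * h ^ 2) + Q * (K * ε) * (K ^ 2 * h ^ 2) +
          Q * (K * h ^ 2 * (2 * (K * ε))) :=
          (abs_add_le _ _).trans (add_le_add ((abs_add_le _ _).trans (add_le_add
            ((abs_add_le _ _).trans (add_le_add t1 t2)) t3)) t4)
      _ = _ := by ring

lemma log (hf : Ctrl f f1 f2 K ε h) (hK : 0 ≤ K) (hε : 0 ≤ ε) {c : ℝ} (hc : 0 < c)
    (hfc : ∀ l ∈ Ioo (-(3 / 2) : ℝ) (3 / 2), c ≤ f l) :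
    ∃ g1 g2, Ctrl (fun l => Real.log (f l)) g1 g2
      ((c⁻¹ + c⁻¹ ^ 2 + 2 * c⁻¹ ^ 3) * (K + 3 * K ^ 2 + K ^ 3)) ε h := by
  have hc' : 0 < c⁻¹ := inv_pos.2 hc
  have hinv : ∀ x ∈ Ici c, 0 < x⁻¹ ∧ x⁻¹ ≤ c⁻¹ := fun x hx =>
    ⟨inv_pos.2 (hc.trans_le hx), inv_anti₀ hc hx⟩
  have hd : ∀ x ∈ Ici c, ∀ y ∈ Ici c, |x⁻¹ - y⁻¹| ≤ c⁻¹ ^ 2 * |x - y| := by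
    intro x hx y hy
    have hx0 : x ≠ 0 := (hc.trans_le hx).ne'
    have hy0 : y ≠ 0 := (hc.trans_le hy).ne'
    obtain ⟨a1, a2⟩ := hinv x hx
    obtain ⟨b1, b2⟩ := hinv y hy
    have : x⁻¹ - y⁻¹ = x⁻¹ * y⁻¹ * (y - x) := by field_simp
    rw [this, abs_mul, abs_of_pos (mul_pos a1 b1), abs_sub_comm y x, sq]
    exact mul_le_mul_of_nonneg_right (mul_le_mul a2 b2 b1.le hc'.le) (abs_nonneg _)
  refine ⟨_, _, hf.comp hK hε (φ := Real.log) (φ1 := fun x => x⁻¹) (φ2 := fun x => -(x ^ 2)⁻¹)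
    (T := Ici c) (by positivity) (fun l hl => ?_)
    (fun l hl => hfc l (Icc_zero_one_subset_Ioo hl)) (fun x hx => ?_) (fun x hx y hy => ?_)⟩
  · have h0 : f l ≠ 0 := (hc.trans_le (hfc l hl)).ne'
    exact ⟨Real.hasDerivAt_log h0, hasDerivAt_inv h0⟩
  · obtain ⟨a1, a2⟩ := hinv x hx
    have a3 : x⁻¹ ^ 2 ≤ c⁻¹ ^ 2 := pow_le_pow_left₀ a1.le a2 2
    have : 0 < c⁻¹ ^ 3 := by positivity
    have : 0 < c⁻¹ ^ 2 := by positivity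
    rw [abs_of_pos a1, abs_neg, ← inv_pow, abs_of_nonneg (by positivity)]
    constructor <;> linarith
  · have h1 := hd x hx y hy
    obtain ⟨a1, a2⟩ := hinv x hx
    obtain ⟨b1, b2⟩ := hinv y hy
    have e : -(x ^ 2)⁻¹ - -(y ^ 2)⁻¹ = -((x⁻¹ - y⁻¹) * (x⁻¹ + y⁻¹)) := by
      rw [← inv_pow, ← inv_pow]; ring
    have h2 : |-(x ^ 2)⁻¹ - -(y ^ 2)⁻¹| ≤ c⁻¹ ^ 2 * |x - y| * (2 * c⁻¹) := by
      rw [e, abs_neg, abs_mul, abs_of_pos (add_pos a1 b1)]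
      exact mul_le_mul h1 (by linarith) (by positivity) (by positivity)
    have h3 : 0 ≤ c⁻¹ * |x - y| := by positivity
    have h4 : 0 ≤ c⁻¹ ^ 2 * |x - y| := by positivity
    have h5 : 0 ≤ c⁻¹ ^ 3 * |x - y| := by positivity
    constructor <;> nlinarith

lemma exp (hf : Ctrl f f1 f2 K ε h) (hK : 0 ≤ K) (hε : 0 ≤ ε) {R : ℝ}
    (hfR : ∀ l ∈ Icc (0 : ℝ) 1, f l ≤ R) :
    ∃ g1 g2, Ctrl (fun l => Real.exp (f l)) g1 g2
      (Real.exp R * (K + 3 * K ^ 2 + K ^ 3)) ε h := by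
  have hb : ∀ x ∈ Iic R, |Real.exp x| ≤ Real.exp R := fun x hx => by
    rw [abs_of_pos (Real.exp_pos x)]; exact Real.exp_le_exp.2 hx
  have hL : ∀ x ∈ Iic R, ∀ y ∈ Iic R, |Real.exp x - Real.exp y| ≤ Real.exp R * |x - y| :=
    fun x hx y hy => (convex_Iic R).norm_image_sub_le_of_norm_hasDerivWithin_le
      (fun z _ => (Real.hasDerivAt_exp z).hasDerivWithinAt) hb hy hx
  exact ⟨_, _, hf.comp hK hε (φ := Real.exp) (φ1 := Real.exp) (φ2 := Real.exp) (T := Iic R)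
    (Real.exp_pos R).le (fun l _ => ⟨Real.hasDerivAt_exp _, Real.hasDerivAt_exp _⟩) hfR
    (fun x hx => ⟨hb x hx, hb x hx⟩) (fun x hx y hy => ⟨hL x hx y hy, hL x hx y hy⟩)⟩

lemma mono (hf : Ctrl f f1 f2 K ε h) {K' : ℝ} (hKK : K ≤ K') (hε : 0 ≤ ε) (hh : 0 ≤ h) :
    Ctrl f f1 f2 K' ε h :=
  ⟨hf.hasDeriv, hf.hasDeriv₁, fun l hl => (hf.le_eps l hl).trans (by gcongr),
    fun l hl => (hf.le_norm l hl).trans (by gcongr), fun l hl => (hf.le_sq l hl).trans (by gcongr),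
    hf.sub_le.trans (by gcongr)⟩

end Ctrl

/-! ### Variations along a ray as ordinary derivatives. -/

lemma hasDerivAt_line {n : ℕ} {J : (USphere n → ℝ) → ℝ} {u : USphere n → ℝ} {g g1 : ℝ → ℝ}
    (hJ : ∀ l ∈ Ioo (-(3 / 2) : ℝ) (3 / 2), J (l • u) = g l)
    (hg : ∀ l ∈ Ioo (-(3 / 2) : ℝ) (3 / 2), HasDerivAt g (g1 l) l) {l : ℝ}
    (hl : l ∈ Ioo (-(3 / 2) : ℝ) (3 / 2)) :
    HasDerivAt (fun r : ℝ => J (l • u + r • u)) (g1 l) 0 := by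
  have h1 : HasDerivAt (fun r : ℝ => g (l + r)) (g1 l) 0 :=
    HasDerivAt.comp_const_add l 0 (by simpa using hg l hl)
  refine h1.congr_of_eventuallyEq ?_
  have h2 : Tendsto (fun r : ℝ => l + r) (𝓝 0) (𝓝 l) := by
    have : Continuous fun r : ℝ => l + r := by fun_prop
    simpa using this.tendsto 0
  filter_upwards [h2.eventually (isOpen_Ioo.mem_nhds hl)] with r hr
  rw [← add_smul, hJ _ hr]

/-- Since `J (l u + r u) = g (l + r)` for small `r`, the first variation at the nearby points `(l +
r) u` is `g' (l + r)`, and differentiating once more gives `g'' l`. -/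
lemma hasSecondVariation_line {n : ℕ} {J : (USphere n → ℝ) → ℝ} {u : USphere n → ℝ}
    {g g1 g2 : ℝ → ℝ} (hJ : ∀ l ∈ Ioo (-(3 / 2) : ℝ) (3 / 2), J (l • u) = g l)
    (hg : ∀ l ∈ Ioo (-(3 / 2) : ℝ) (3 / 2), HasDerivAt g (g1 l) l)
    (hg1 : ∀ l ∈ Ioo (-(3 / 2) : ℝ) (3 / 2), HasDerivAt g1 (g2 l) l) {l : ℝ}
    (hl : l ∈ Ioo (-(3 / 2) : ℝ) (3 / 2)) :
    HasSecondVariation J (l • u) u u ∧ secondVariation J (l • u) u u = g2 l := by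
  have h2 : Tendsto (fun r : ℝ => l + r) (𝓝 0) (𝓝 l) := by
    have : Continuous fun r : ℝ => l + r := by fun_prop
    simpa using this.tendsto 0
  have h3 := h2.eventually (isOpen_Ioo.mem_nhds hl)
  have hfv : ∀ᶠ r : ℝ in 𝓝 0, firstVariation J (l • u + r • u) u = g1 (l + r) := by
    filter_upwards [h3] with r hr
    rw [firstVariation, ← add_smul]
    exact (hasDerivAt_line hJ hg hr).deriv
  have hd : HasDerivAt (fun r : ℝ => firstVariation J (l • u + r • u) u) (g2 l) 0 :=
    (HasDerivAt.comp_const_add l 0 (by simpa using hg1 l hl)).congr_of_eventuallyEq hfv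
  refine ⟨⟨?_, hd.differentiableAt⟩, hd.deriv⟩
  filter_upwards [h3] with q hq
  rw [← add_smul]
  exact (hasDerivAt_line hJ hg hq).differentiableAt

/-! ### Comparison with the C¹ and Sobolev norms. -/

section norms

variable {n : ℕ} {u : USphere n → ℝ} {ε : ℝ}

lemma gagliardoSq_eq (t : ℝ) (u : USphere n → ℝ) : gagliardoSq ((1 + t) / 2) u =
    ∫ z, gagDens (n + t) u z ∂((surf n).prod (surf n)) := by
  unfold gagliardoSq gagDens
  rw [show (n : ℝ) - 1 + 2 * ((1 + t) / 2) = n + t by ring]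

lemma sobolevNorm_sq (t : ℝ) (u : USphere n → ℝ) : sobolevNorm ((1 + t) / 2) u ^ 2 =
    (∫ ξ, u ξ ^ 2 ∂(surf n)) + ∫ z, gagDens (n + t) u z ∂((surf n).prod (surf n)) := by
  rw [sobolevNorm, gagliardoSq_eq, Real.sq_sqrt]
  exact add_nonneg (integral_nonneg fun _ => sq_nonneg _)
    (integral_nonneg fun z => gagDens_nonneg _ z)

/-- The chordal distance is at most `2` and `t - s ≤ 1`, so raising the exponent from `n + s` to `n
+ t` costs at most a factor `2`. This lets the norm of order `t` control both perimeters. -/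
lemma gagDens_le_of_le {s t : ℝ} (hs : 0 < s) (hst : s ≤ t) (ht : t < 1)
    (z : USphere n × USphere n) : gagDens (n + s) u z ≤ 2 * gagDens (n + t) u z := by
  unfold gagDens
  have h2 := norm_sub_sphere_le_two z.1 z.2
  rcases (norm_nonneg ((z.1 : Eucl n) - (z.2 : Eucl n))).eq_or_lt with h0 | h0
  · rw [← h0, Real.zero_rpow (by positivity), Real.zero_rpow (by
      have : (0 : ℝ) < n + t := by positivity [hs.trans_le hst]
      exact this.ne')]
    simp
  · set θ := ‖(z.1 : Eucl n) - (z.2 : Eucl n)‖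
    have h3 : θ ^ ((n : ℝ) + t) ≤ 2 * θ ^ ((n : ℝ) + s) := by
      rw [show (n : ℝ) + t = (t - s) + (n + s) by ring, Real.rpow_add h0]
      refine mul_le_mul_of_nonneg_right ?_ (by positivity)
      calc θ ^ (t - s) ≤ 2 ^ (t - s) := Real.rpow_le_rpow h0.le h2 (by linarith)
        _ ≤ 2 ^ (1 : ℝ) := Real.rpow_le_rpow_of_exponent_le (by norm_num) (by linarith)
        _ = 2 := Real.rpow_one 2
    rw [← mul_div_assoc, div_le_div_iff₀ (by positivity) (by positivity)]
    nlinarith [mul_le_mul_of_nonneg_left h3 (sq_nonneg (u z.1 - u z.2))]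

/-- Cauchy–Schwarz, obtained by integrating the square of `S |u| - ∫ |u|`, with `S` the total mass
of the sphere. -/
lemma LipBound.sq_integral_abs_le (hu : LipBound u ε) (hn : 1 ≤ n) :
    (∫ ξ, |u ξ| ∂(surf n)) ^ 2 ≤ (surf n).real univ * ∫ ξ, u ξ ^ 2 ∂(surf n) := by
  have hum := hu.cont.measurable
  have hi1 : Integrable (fun ξ => |u ξ|) (surf n) :=
    (integrable_const ε).mono' (Measurable.aestronglyMeasurable (by fun_prop))
      (Eventually.of_forall fun ξ => by simpa using hu.abs_le ξ)
  have hi2 : Integrable (fun ξ => u ξ ^ 2) (surf n) :=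
    (integrable_const (ε ^ 2)).mono' (Measurable.aestronglyMeasurable (by fun_prop))
      (Eventually.of_forall fun ξ => by
        rw [Real.norm_eq_abs, abs_pow]
        exact pow_le_pow_left₀ (abs_nonneg _) (hu.abs_le ξ) 2)
  set S := (surf n).real univ with hS
  have hS0 : 0 < S :=
    ENNReal.toReal_pos (surf_univ_ne_zero hn) (measure_ne_top _ _)
  set U1 := ∫ ξ, |u ξ| ∂(surf n)
  set U2 := ∫ ξ, u ξ ^ 2 ∂(surf n)
  have h : 0 ≤ ∫ ξ, (S * |u ξ| - U1) ^ 2 ∂(surf n) := integral_nonneg fun _ => sq_nonneg _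
  have e : ∫ ξ, (S * |u ξ| - U1) ^ 2 ∂(surf n) = S ^ 2 * U2 - 2 * S * U1 * U1 + U1 ^ 2 * S := by
    have : ∀ ξ, (S * |u ξ| - U1) ^ 2 = S ^ 2 * u ξ ^ 2 - 2 * S * U1 * |u ξ| + U1 ^ 2 := fun ξ => by
      rw [← sq_abs (u ξ)]; ring
    simp only [this]
    have hsub : Integrable (fun ξ => S ^ 2 * u ξ ^ 2 - 2 * S * U1 * |u ξ|) (surf n) :=
      (hi2.const_mul _).sub (hi1.const_mul _)
    rw [integral_add hsub (integrable_const _),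
      integral_sub (hi2.const_mul _) (hi1.const_mul _), integral_const_mul, integral_const_mul,
      integral_const, smul_eq_mul, ← hS]
    ring
  rw [e] at h
  have h' : 0 ≤ S * (S * U2 - U1 ^ 2) := by nlinarith
  have := nonneg_of_mul_nonneg_right h' hS0
  linarith

lemma exists_ctrl_perimFun (hn : 1 ≤ n) {α t : ℝ} (hα : 0 < α) (hαt : α ≤ t) (ht : t < 1) :
    ∃ K : ℝ, 0 ≤ K ∧ ∀ (u : USphere n → ℝ) (ε : ℝ), LipBound u ε →
      perimFun n α u 0 ≤ K ∧
      ∃ p1 p2, Ctrl (perimFun n α u) p1 p2 K ε (sobolevNorm ((1 + t) / 2) u) := by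
  have ht0 := hα.trans_le hαt
  have hα1 := hαt.trans_lt ht
  obtain ⟨K, hK0, hK⟩ := exists_bound_perimFun (n := n) hn hα hα1
  set S := (surf n).real univ
  have hS0 : 0 ≤ S := measureReal_nonneg
  have hJ := integrable_sq_div_rpow (n := n) hn ht0 ht
  set J := ∫ p : USphere n × USphere n, ‖(p.1 : Eucl n) - (p.2 : Eucl n)‖ ^ 2 /
      ‖(p.1 : Eucl n) - (p.2 : Eucl n)‖ ^ ((n : ℝ) + t) ∂((surf n).prod (surf n))
  have hJ0 : 0 ≤ J := integral_nonneg fun p => by positivity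
  refine ⟨K * (4 + S + 4 * J), by positivity, fun u ε hu => ?_⟩
  obtain ⟨p1, p2, hp0, hp, hp'⟩ := hK u ε hu
  refine ⟨hp0.trans (le_mul_of_one_le_right hK0 (by linarith)), p1, p2, ?_⟩
  have hε0 := hu.nonneg
  have hε1 := hu.le_half
  have hU1S := hu.sq_integral_abs_le hn
  have hXle : ∫ z, gagDens (n + α) u z ∂((surf n).prod (surf n)) ≤
      2 * ∫ z, gagDens (n + t) u z ∂((surf n).prod (surf n)) := by
    rw [← integral_const_mul]
    exact integral_mono (hu.integrable_gagDens hn hα hα1)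
      ((hu.integrable_gagDens hn ht0 ht).const_mul 2) fun z => gagDens_le_of_le hα hαt ht z
  have hXt : ∫ z, gagDens (n + t) u z ∂((surf n).prod (surf n)) ≤ (2 * ε) ^ 2 * J := by
    rw [← integral_const_mul]
    exact integral_mono (hu.integrable_gagDens hn ht0 ht) (hJ.const_mul _) fun z =>
      hu.gagDens_le _ z
  have hU1e : ∫ ξ, |u ξ| ∂(surf n) ≤ S * ε := by
    have h1 : ∫ ξ, |u ξ| ∂(surf n) ≤ ∫ _ξ : USphere n, ε ∂(surf n) :=
      integral_mono_of_nonneg (Eventually.of_forall fun _ => abs_nonneg _) (integrable_const _)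
        (Eventually.of_forall hu.abs_le)
    rwa [integral_const, smul_eq_mul] at h1
  have hh := sobolevNorm_sq t u
  have hh0 : 0 ≤ sobolevNorm ((1 + t) / 2) u := Real.sqrt_nonneg _
  have hX0 : 0 ≤ ∫ z, gagDens (n + t) u z ∂((surf n).prod (surf n)) :=
    integral_nonneg fun z => gagDens_nonneg _ z
  have hU2 : 0 ≤ ∫ ξ, u ξ ^ 2 ∂(surf n) := integral_nonneg fun _ => sq_nonneg _
  set h := sobolevNorm ((1 + t) / 2) u
  set X := ∫ z, gagDens (n + α) u z ∂((surf n).prod (surf n))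
  set Y := ∫ z, gagDens (n + t) u z ∂((surf n).prod (surf n))
  set U1 := ∫ ξ, |u ξ| ∂(surf n)
  set U2 := ∫ ξ, u ξ ^ 2 ∂(surf n)
  -- The Gagliardo term is quadratic in `u`, yet the first derivative needs bounds linear in `ε` and
  -- in `h`. From `Y ≤ 4 ε² J` and `ε ≤ 1/2` follow `Y ≤ 2 J ε` and `Y ≤ J`, and then `Y² ≤ J h²`.
  have hYe : Y ≤ 2 * J * ε := by nlinarith [mul_nonneg hJ0 hε0]
  have hYJ : Y ≤ J := by nlinarith
  have hYh : Y ≤ (1 + J) * h := by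
    refine le_of_sq_le_sq ?_ (by positivity)
    calc Y ^ 2 = Y * Y := sq Y
      _ ≤ J * h ^ 2 := mul_le_mul hYJ (by linarith) hX0 hJ0
      _ ≤ (1 + J) ^ 2 * h ^ 2 := mul_le_mul_of_nonneg_right (by nlinarith) (sq_nonneg h)
      _ = _ := by ring
  have hUh : U1 ≤ (1 + S) * h := by
    refine le_of_sq_le_sq ?_ (by positivity)
    calc U1 ^ 2 ≤ S * U2 := hU1S
      _ ≤ S * h ^ 2 := mul_le_mul_of_nonneg_left (by linarith) hS0
      _ ≤ (1 + S) ^ 2 * h ^ 2 := mul_le_mul_of_nonneg_right (by nlinarith) (sq_nonneg h)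
      _ = _ := by ring
  have hsum : U2 + X ≤ (4 + S + 4 * J) * h ^ 2 := by
    nlinarith [mul_nonneg hS0 (sq_nonneg h), mul_nonneg hJ0 (sq_nonneg h), sq_nonneg h]
  have hIoo := Icc_zero_one_subset_Ioo
  refine ⟨fun l hl => (hp l hl).1, fun l hl => (hp l hl).2.1, fun l hl => ?_, fun l hl => ?_,
    fun l hl => ?_, ?_⟩
  · refine (hp l (hIoo hl)).2.2.1.trans ?_
    rw [mul_assoc]
    refine mul_le_mul_of_nonneg_left ?_ hK0
    nlinarith
  · refine (hp l (hIoo hl)).2.2.1.trans ?_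
    rw [mul_assoc]
    refine mul_le_mul_of_nonneg_left ?_ hK0
    nlinarith [mul_nonneg hJ0 hh0]
  · refine (hp l (hIoo hl)).2.2.2.trans ?_
    rw [mul_assoc]
    exact mul_le_mul_of_nonneg_left hsum hK0
  · refine hp'.trans ?_
    calc K * ε * (U2 + X) ≤ K * ε * ((4 + S + 4 * J) * h ^ 2) :=
          mul_le_mul_of_nonneg_left hsum (mul_nonneg hK0 hε0)
      _ = _ := by ring

end norms

/-! ### The isoperimetric ratio and the conclusion. -/

lemma ratioFun_smul_eq {n : ℕ} (hn : 1 ≤ n) {s t : ℝ} (hs : 0 < s) (hst : s < t) (ht : t < 1)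
    {u : USphere n → ℝ} {ε : ℝ} (hu : LipBound u ε) {l : ℝ}
    (hl : l ∈ Icc (-(3 / 2) : ℝ) (3 / 2)) (hps : 0 < perimFun n s u l)
    (hpt : 0 < perimFun n t u l) :
    ratioFun s t (l • u) = Real.exp (1 / ((n : ℝ) - t) * Real.log (perimFun n t u l) -
      1 / ((n : ℝ) - s) * Real.log (perimFun n s u l)) := by
  rw [ratioFun, isoRatio, fracPerimeter_graphSet_smul hn hs (hst.trans ht) hu hl,
    fracPerimeter_graphSet_smul hn (hs.trans hst) ht hu hl, ENNReal.toReal_ofReal hps.le,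
    ENNReal.toReal_ofReal hpt.le, Real.rpow_def_of_pos hps, Real.rpow_def_of_pos hpt,
    ← Real.exp_sub, mul_comm (Real.log _), mul_comm (Real.log (perimFun n s u l))]

lemma exists_ctrl_ratioFun {n : ℕ} (hn : 1 ≤ n) {s t : ℝ} (hs : 0 < s) (hst : s < t)
    (ht : t < 1) :
    ∃ K : ℝ, 0 ≤ K ∧ ∀ (u : USphere n → ℝ) (ε : ℝ), LipBound u ε → ∃ g g1 g2 : ℝ → ℝ,
      (∀ l ∈ Ioo (-(3 / 2) : ℝ) (3 / 2), ratioFun s t (l • u) = g l) ∧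
      Ctrl g g1 g2 K ε (sobolevNorm ((1 + t) / 2) u) := by
  have ht0 := hs.trans hst
  have hs1 := hst.trans ht
  have hn' : (1 : ℝ) ≤ n := by exact_mod_cast hn
  obtain ⟨Ks, hKs0, hKs⟩ := exists_ctrl_perimFun hn hs hst.le ht
  obtain ⟨Kt, hKt0, hKt⟩ := exists_ctrl_perimFun hn ht0 le_rfl ht
  obtain ⟨cs, hcs0, hcs⟩ := exists_pos_le_perimFun hn hs hs1
  obtain ⟨ct, hct0, hct⟩ := exists_pos_le_perimFun hn ht0 ht
  set Bs := (cs⁻¹ + cs⁻¹ ^ 2 + 2 * cs⁻¹ ^ 3) * (Ks + 3 * Ks ^ 2 + Ks ^ 3)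
  set Bt := (ct⁻¹ + ct⁻¹ ^ 2 + 2 * ct⁻¹ ^ 3) * (Kt + 3 * Kt ^ 2 + Kt ^ 3)
  have hBs : 0 ≤ Bs := by positivity
  have ha : 0 ≤ 1 / ((n : ℝ) - t) := one_div_nonneg.2 (by linarith)
  have hb : 0 ≤ 1 / ((n : ℝ) - s) := one_div_nonneg.2 (by linarith)
  set a := 1 / ((n : ℝ) - t)
  set b := 1 / ((n : ℝ) - s)
  set B := (a + b) * max Bs Bt
  have hB : 0 ≤ B := mul_nonneg (add_nonneg ha hb) (le_max_of_le_left hBs)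
  -- Upper bound for the exponent: `P_t ≤ Kt + Kt ε ≤ 2 Kt` by the value at `l = 0` and the
  -- variation on `[0, 1]`, while `P_s ≥ cs`.
  set R := a * Real.log (2 * Kt) - b * Real.log cs
  refine ⟨Real.exp R * (B + 3 * B ^ 2 + B ^ 3), by positivity, fun u ε hu => ?_⟩
  have hε := hu.nonneg
  have hh0 : 0 ≤ sobolevNorm ((1 + t) / 2) u := Real.sqrt_nonneg _
  obtain ⟨-, ps1, ps2, hps⟩ := hKs u ε hu
  obtain ⟨hpt0, pt1, pt2, hpt⟩ := hKt u ε hu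
  have hcs' : ∀ l ∈ Ioo (-(3 / 2) : ℝ) (3 / 2), cs ≤ perimFun n s u l :=
    fun l hl => hcs u ε hu l (Ioo_subset_Icc_self hl)
  have hct' : ∀ l ∈ Ioo (-(3 / 2) : ℝ) (3 / 2), ct ≤ perimFun n t u l :=
    fun l hl => hct u ε hu l (Ioo_subset_Icc_self hl)
  obtain ⟨ls1, ls2, hls⟩ := hps.log hKs0 hε hcs0 hcs'
  obtain ⟨lt1, lt2, hlt⟩ := hpt.log hKt0 hε hct0 hct'
  have hlin := (hlt.mono (le_max_right Bs Bt) hε hh0).linear_sub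
    (hls.mono (le_max_left Bs Bt) hε hh0) ha hb
  obtain ⟨g1, g2, hg⟩ := hlin.exp hB hε (R := R) fun l hl => by
    have hl' := Icc_zero_one_subset_Ioo hl
    have h1 := (abs_le.1 (hpt.abs_sub_le hl)).2
    have h2 : Kt * ε ≤ Kt := mul_le_of_le_one_right hKt0 (by linarith [hu.le_half])
    have h3 : Real.log (perimFun n t u l) ≤ Real.log (2 * Kt) :=
      Real.log_le_log (hct0.trans_le (hct' l hl')) (by linarith)
    have h4 : Real.log cs ≤ Real.log (perimFun n s u l) := Real.log_le_log hcs0 (hcs' l hl')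
    exact sub_le_sub (mul_le_mul_of_nonneg_left h3 ha) (mul_le_mul_of_nonneg_left h4 hb)
  exact ⟨_, g1, g2, fun l hl => ratioFun_smul_eq hn hs hst ht hu (Ioo_subset_Icc_self hl)
    (hcs0.trans_le (hcs' l hl)) (hct0.trans_le (hct' l hl)), hg⟩

end FracIso

end

theorem proposition5p5 (n : ℕ) (hn : 2 ≤ n) (s t : ℝ) (hs : 0 < s) (hst : s < t) (ht : t < 1) :
    ∃ C : ℝ, 0 < C ∧
      ∀ u : FracIso.USphere n → ℝ, FracIso.IsC1 u → FracIso.c1Norm u ≤ 1 / 2 →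
        volume (FracIso.graphSet u) = volume (Metric.closedBall (0 : FracIso.Eucl n) 1) →
        (∀ r ∈ Set.Icc (0 : ℝ) 1, ∀ α ∈ ({s, t} : Set ℝ),
          0 < FracIso.fracPerimeter α (FracIso.graphSet (r • u)) ∧
            FracIso.fracPerimeter α (FracIso.graphSet (r • u)) < ⊤) ∧
        FracIso.HasSecondVariation (FracIso.ratioFun s t) u u u ∧
        FracIso.HasSecondVariation (FracIso.ratioFun s t) 0 u u ∧
        |FracIso.secondVariation (FracIso.ratioFun s t) u u u -
            FracIso.secondVariation (FracIso.ratioFun s t) 0 u u| ≤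
          C * FracIso.c1Norm u * FracIso.sobolevNorm ((1 + t) / 2) u ^ 2 := by
  have hn1 : 1 ≤ n := by omega
  obtain ⟨K, hK0, hK⟩ := FracIso.exists_ctrl_ratioFun (n := n) hn1 hs hst ht
  -- `K` is only known to be nonnegative; adding `1` makes the constant positive.
  refine ⟨K + 1, by linarith, fun u hu hu2 _ => ?_⟩
  have hlip := hu.lipBound hu2
  obtain ⟨g, g1, g2, hJ, hg⟩ := hK u _ hlip
  have h1 := FracIso.hasSecondVariation_line hJ hg.hasDeriv hg.hasDeriv₁ (l := 1) (by norm_num)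
  have h0 := FracIso.hasSecondVariation_line hJ hg.hasDeriv hg.hasDeriv₁ (l := 0) (by norm_num)
  rw [one_smul] at h1
  rw [zero_smul] at h0
  refine ⟨fun r hr α hα => ?_, h1.1, h0.1, ?_⟩
  · have hr' : r ∈ Icc (-(3 / 2) : ℝ) (3 / 2) :=
      Ioo_subset_Icc_self (FracIso.Icc_zero_one_subset_Ioo hr)
    have hα01 : 0 < α ∧ α < 1 := by
      rcases hα with rfl | rfl
      · exact ⟨hs, hst.trans ht⟩
      · exact ⟨hs.trans hst, ht⟩
    obtain ⟨c, hc0, hc⟩ := FracIso.exists_pos_le_perimFun (n := n) hn1 hα01.1 hα01.2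
    rw [FracIso.fracPerimeter_graphSet_smul hn1 hα01.1 hα01.2 hlip hr']
    exact ⟨ENNReal.ofReal_pos.2 (hc0.trans_le (hc u _ hlip r hr')), ENNReal.ofReal_lt_top⟩
  · rw [h1.2, h0.2]
    refine hg.sub_le.trans ?_
    have := FracIso.c1Norm_nonneg u
    gcongr
    linarith
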